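/- For $\lambda>0$ let $\Pi$ be a Poisson point process with intensity $\lambda$ on $\{1,2,\dots\}\times[0,1]$, i.e. for each $k\ge 1$ the number of points of $\Pi$ in $\{k\}\times[0,1]$ is Poisson with mean $\lambda$, the second coordinates of the points are uniform on $[0,1]$, and all these variables are independent. Let $\{U_{k,j}: k\ge 0,\ 1\le j\le 2^k\}$ be independent uniform random variables on $[0,1]$, independent of $\Pi$. Define $Y_{0,0}=0$, $Y_{0,1}=1$, $Y_{k+1,2j}=Y_{k,j}$ for $0\le j\le 2^k$ and $Y_{k+1,2j-1}=(1-U_{k,j})Y_{k,j-1}+U_{k,j}Y_{k,j}$ for $1\le j\le 2^k$. For $k\ge1$ and $x\in[0,1)$ let $J_k(x)=2j-1$ if $Y_{k-1,j-1}\le x<Y_{k-1,j}$, and set $$X(\lambda)=\frac1\lambda\sum_{(k,x)\in\Pi}\bigl|x-Y_{k,J_k(x)}\bigr| .$$ Then for every integer $n\ge 1$ there is a real polynomial $Q_n$ of degree exactly $n$ with $Q_n(0)=0$ such that for every $\lambda>0$ the sum is almost surely finite, $X(\lambda)^n$ is integrable, and $\lambda^n\,\mathbb{E}[X(\lambda)^n]=Q_n(\lambda)$.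 -/

import Mathlib

namespace RandomSplit

/-- The split points `Y k j` (`0 ≤ j ≤ 2 ^ k`) of generation `k`, built from an array `u k j`
(`1 ≤ j ≤ 2 ^ k`) of numbers in `[0, 1]`:
`Y 0 0 = 0`, `Y 0 1 = 1`, `Y (k+1) (2i) = Y k i` and
`Y (k+1) (2i-1) = (1 - u k i) * Y k (i-1) + u k i * Y k i`.
(For odd `j = 2i-1` one has `i-1 = j/2` and `i = j/2 + 1`.
Values at indices `j > 2 ^ k` are never used.) -/
def Y (u : ℕ → ℕ → ℝ) : ℕ → ℕ → ℝ
  | 0, j => if j = 0 then 0 else 1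
  | k + 1, j =>
    if Even j then Y u k (j / 2)
    else (1 - u k (j / 2 + 1)) * Y u k (j / 2) + u k (j / 2 + 1) * Y u k (j / 2 + 1)

/-- `J u k x = 2j - 1`, where `j` with `1 ≤ j ≤ 2 ^ (k-1)` is the index of the interval
`[Y (k-1) (j-1), Y (k-1) j)` of generation `k - 1` that contains `x`. If the `u k j` lie in `[0, 1]`,
then this index exists and is unique for all `x` in `[0, 1)`. -/
noncomputable def J (u : ℕ → ℕ → ℝ) (k : ℕ+) (x : ℝ) : ℕ :=
  2 * sInf {j : ℕ | 1 ≤ j ∧ j ≤ 2 ^ ((k : ℕ) - 1) ∧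
    Y u ((k : ℕ) - 1) (j - 1) ≤ x ∧ x < Y u ((k : ℕ) - 1) j} - 1

/-- The distance from `x` to the point at which the interval of generation `k - 1` that
contains `x` is cut at step `k`. -/
noncomputable def cutDist (u : ℕ → ℕ → ℝ) (p : ℕ+ × ℝ) : ℝ :=
  |p.2 - Y u p.1 (J u p.1 p.2)|

/-- `X(lam) = (1 / lam) * ∑_{(k, x) ∈ S} |x - Y_{k, J_k(x)}|` for a set `S` of points
of `ℕ+ × [0, 1]`. -/
noncomputable def X (lam : ℝ) (S : Set (ℕ+ × ℝ)) (u : ℕ → ℕ → ℝ) : ℝ :=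
  1 / lam * ∑' p : S, cutDist u p

/-- The indices `(k, j)` with `k ≥ 0` and `1 ≤ j ≤ 2 ^ k`. -/
abbrev SplitIndex : Type := {p : ℕ × ℕ // 1 ≤ p.2 ∧ p.2 ≤ 2 ^ p.1}

open MeasureTheory ProbabilityTheory in
/-- On the probability space `(Ω, P)`, the random set `S` is a Poisson point process with
intensity `lam` on `ℕ+ × [0, 1]`: its layer `{k} × [0, 1]` consists of the `N k` points
`(k, V k i)`, `i < N k`, where `N k` is Poisson with mean `lam` and the `V k i` are uniform
on `[0, 1]`; and `U k j` (`k ≥ 0`, `1 ≤ j ≤ 2 ^ k`) is an array of uniform random variables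
on `[0, 1]`. All the variables `N k`, `V k i`, `U k j` are independent. -/
structure IsModel {Ω : Type*} [MeasurableSpace Ω] (P : Measure Ω) (lam : ℝ)
    (N : ℕ+ → Ω → ℕ) (V : ℕ+ → ℕ → Ω → ℝ) (S : Ω → Set (ℕ+ × ℝ)) (U : ℕ → ℕ → Ω → ℝ) :
    Prop where
  law_N : ∀ k, HasLaw (N k) (poissonMeasure lam.toNNReal) P
  law_V : ∀ k i, HasLaw (V k i) (volume.restrict (Set.Icc (0 : ℝ) 1)) P
  law_U : ∀ q : SplitIndex, HasLaw (U q.1.1 q.1.2) (volume.restrict (Set.Icc (0 : ℝ) 1)) P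
  indep : iIndepFun (fun (a : ℕ+ ⊕ (ℕ+ × ℕ) ⊕ SplitIndex) (ω : Ω) =>
    match a with
    | .inl k => (N k ω : ℝ)
    | .inr (.inl (k, i)) => V k i ω
    | .inr (.inr q) => U q.1.1 q.1.2 ω) P
  points : ∀ᵐ ω ∂P, S ω = {p | ∃ i < N p.1 ω, p.2 = V p.1 i ω}

end RandomSplit

/-! Given the split ratios `v`, the total cut distance is a sum of a function over a Poisson
process, so its cumulant of order `n + 1` is `lam * cutCumulant v n`. Moments are Bell polynomials
in the cumulants. Collecting powers of `lam`, the conditional `n`-th moment is a polynomial in `lam`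
of degree at most `n`, with `n`-th coefficient `cutCumulant v 0 ^ n` and, for `n ≥ 1`, no constant
term. Averaging over `v` gives `momentPolynomial n`, whose coefficients involve neither `lam` nor
the probability space (`lintegral_totalGap_pow`). The degree is exact because `cutCumulant v 0` is
almost surely positive.

The analytic point is that these averages are finite. Cut distances are at most 1, so every
`cutCumulant v n` is at most `cutCumulant v 0`, and it suffices that the latter has all moments.
Generation `k` contributes to it at most the sum of the squares of its `2 ^ k` interval lengths.
Each length is a product of `k` independent uniform factors with second moment `1/3`, so the mean
contribution is at most `(2/3) ^ k`; `lintegral_tsum_pow_ne_top` turns this decay into moments of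
every order.

The conditional moments are computed in `[0, ∞]` with formal exponential generating functions. A
compound Poisson series satisfies `F' = r φ' F`, which avoids exponentials, logarithms and questions
of convergence. Monotone convergence passes from finitely many layers to all of them. -/

namespace RandomSplit

open MeasureTheory ProbabilityTheory
open scoped ENNReal NNReal

/-! ### Independence of functions of disjoint coordinates -/

section Independence

variable {ι : Type*} {μ : ι → Measure ℝ} [∀ i, IsProbabilityMeasure (μ i)]

/-- A measurable function that depends only on the coordinates in `s` is measurable with respect to
the σ-algebra generated by these coordinates. -/
lemma measurable_iSup_comap_of_dependsOn {β : Type*} [MeasurableSpace β] {s : Set ι}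
    {φ : (ι → ℝ) → β} (hφ : Measurable φ) (h : DependsOn φ s) :
    Measurable[⨆ i ∈ s, MeasurableSpace.comap (fun w : ι → ℝ => w i) inferInstance] φ := by
  classical
  set m : MeasurableSpace (ι → ℝ) :=
    ⨆ i ∈ s, MeasurableSpace.comap (fun w : ι → ℝ => w i) inferInstance
  -- Resetting the coordinates outside `s` to 0 does not change `φ`, and the reset map is measurable
  -- for the smaller σ-algebra.
  have key : φ = φ ∘ fun w i => if i ∈ s then w i else 0 := by
    ext w
    exact h fun i hi => by simp [hi]
  rw [key]
  refine hφ.comp ?_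
  refine @measurable_pi_lambda _ _ _ m _ _ fun i => ?_
  by_cases hi : i ∈ s
  · simp only [hi, if_true]
    exact (comap_measurable (m := inferInstance) (fun w : ι → ℝ => w i)).mono
      (le_iSup₂_of_le (f := fun (i : ι) (_ : i ∈ s) =>
        MeasurableSpace.comap (fun w : ι → ℝ => w i) inferInstance) i hi le_rfl) le_rfl
  · simp only [hi, if_false]
    exact measurable_const

/-- Under a product measure, functions of disjoint sets of coordinates are independent. -/
lemma indepFun_of_dependsOn {β γ : Type*} [MeasurableSpace β] [MeasurableSpace γ]
    {s t : Set ι} (hst : Disjoint s t) {φ : (ι → ℝ) → β} {ψ : (ι → ℝ) → γ}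
    (hφ : Measurable φ) (hψ : Measurable ψ) (hs : DependsOn φ s) (ht : DependsOn ψ t) :
    IndepFun φ ψ (Measure.infinitePi μ) := by
  have h0 : iIndepFun (fun (i : ι) (w : ι → ℝ) => w i) (Measure.infinitePi μ) :=
    iIndepFun_infinitePi (X := fun _ x => x) (fun i => measurable_id)
  have h1 := indep_iSup_of_disjoint (fun i => (measurable_pi_apply i).comap_le) h0.iIndep hst
  exact indep_of_indep_of_le h1 (measurable_iSup_comap_of_dependsOn hφ hs).comap_le
    (measurable_iSup_comap_of_dependsOn hψ ht).comap_le

end Independence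

/-! ### Moment generating series of compound Poisson variables -/

section MomentSeries

variable {Ω : Type*} [MeasurableSpace Ω] {P : Measure Ω}

/-- The exponential generating function of the moments of a `[0, ∞]`-valued random variable. -/
noncomputable def momentSeries (P : Measure Ω) (X : Ω → ℝ≥0∞) : PowerSeries ℝ≥0∞ :=
  PowerSeries.mk fun n => (∫⁻ ω, X ω ^ n ∂P) * ((n.factorial : ℝ≥0∞))⁻¹

lemma coeff_momentSeries (X : Ω → ℝ≥0∞) (n : ℕ) :
    PowerSeries.coeff n (momentSeries P X) = (∫⁻ ω, X ω ^ n ∂P) * ((n.factorial : ℝ≥0∞))⁻¹ :=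
  PowerSeries.coeff_mk _ _

lemma choose_mul_inv_factorial {n i j : ℕ} (h : i + j = n) :
    (n.choose i : ℝ≥0∞) * (n.factorial : ℝ≥0∞)⁻¹
      = (i.factorial : ℝ≥0∞)⁻¹ * (j.factorial : ℝ≥0∞)⁻¹ := by
  have h0 : ∀ m : ℕ, (m.factorial : ℝ≥0∞) ≠ 0 := fun m => by
    exact_mod_cast m.factorial_ne_zero
  have ht : ∀ m : ℕ, (m.factorial : ℝ≥0∞) ≠ ∞ := fun m => ENNReal.natCast_ne_top _
  have h1 : (n.factorial : ℝ≥0∞) = n.choose i * (i.factorial * j.factorial) := by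
    subst h
    exact_mod_cast (by rw [← mul_assoc, Nat.choose_symm_add, Nat.add_choose_mul_factorial_mul_factorial] :
      (i + j).factorial = (i + j).choose i * (i.factorial * j.factorial))
  have h2 : (n.choose i : ℝ≥0∞) ≠ 0 := by
    exact_mod_cast (Nat.choose_pos (by omega)).ne'
  rw [h1, ENNReal.mul_inv (Or.inl h2) (Or.inl (ENNReal.natCast_ne_top _)), ← mul_assoc,
    ENNReal.mul_inv_cancel h2 (ENNReal.natCast_ne_top _), one_mul,
    ENNReal.mul_inv (Or.inl (h0 _)) (Or.inl (ht _))]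

/-- Binomial expansion and independence; division by `n!` turns the binomial convolution of moments
into a product of series. With values in `[0, ∞]` no integrability is required. -/
lemma momentSeries_add {X Y : Ω → ℝ≥0∞} (hX : Measurable X) (hY : Measurable Y)
    (h : IndepFun X Y P) :
    momentSeries P (fun ω => X ω + Y ω) = momentSeries P X * momentSeries P Y := by
  ext n
  have hadd : ∀ ω, (X ω + Y ω) ^ n = ∑ p ∈ Finset.HasAntidiagonal.antidiagonal n,
      n.choose p.1 • (X ω ^ p.1 * Y ω ^ p.2) := fun ω => (Commute.all (X ω) (Y ω)).add_pow' n
  rw [PowerSeries.coeff_mul, coeff_momentSeries]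
  simp_rw [coeff_momentSeries, hadd]
  rw [lintegral_finsetSum _ (fun p _ => by fun_prop), Finset.sum_mul]
  refine Finset.sum_congr rfl fun p hp => ?_
  have hp' := Finset.HasAntidiagonal.mem_antidiagonal.1 hp
  have hi : ∫⁻ ω, X ω ^ p.1 * Y ω ^ p.2 ∂P = (∫⁻ ω, X ω ^ p.1 ∂P) * ∫⁻ ω, Y ω ^ p.2 ∂P :=
    lintegral_mul_eq_lintegral_mul_lintegral_of_indepFun (hX.pow_const _) (hY.pow_const _)
      (h.comp (measurable_id.pow_const p.1) (measurable_id.pow_const p.2))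
  simp_rw [nsmul_eq_mul]
  rw [lintegral_const_mul _ (by fun_prop), hi, mul_right_comm, choose_mul_inv_factorial hp']
  ring

lemma momentSeries_zero [IsProbabilityMeasure P] : momentSeries P (fun _ => 0) = 1 := by
  ext n
  rw [coeff_momentSeries, PowerSeries.coeff_one]
  rcases n with _ | n <;> simp

lemma momentSeries_sum_range [IsProbabilityMeasure P] {Z : ℕ → Ω → ℝ≥0∞}
    {φ : PowerSeries ℝ≥0∞} (hZ : ∀ i, Measurable (Z i)) (hφ : ∀ i, momentSeries P (Z i) = φ)
    (h : ∀ m, IndepFun (fun ω => ∑ i ∈ Finset.range m, Z i ω) (Z m) P) (m : ℕ) :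
    momentSeries P (fun ω => ∑ i ∈ Finset.range m, Z i ω) = φ ^ m := by
  induction m with
  | zero => simpa using momentSeries_zero
  | succ m ih =>
    simp_rw [Finset.sum_range_succ]
    rw [momentSeries_add (by fun_prop) (hZ m) (h m), ih, hφ, pow_succ]

/-- This recursion is all that the differential equation uses of the Poisson weights. -/
lemma succ_mul_poissonMeasure (r : ℝ≥0) (m : ℕ) :
    ((m : ℝ≥0∞) + 1) * poissonMeasure r {m + 1} = r * poissonMeasure r {m} := by
  rw [poissonMeasure_singleton, poissonMeasure_singleton]
  have : ((m : ℝ≥0∞) + 1) = ENNReal.ofReal (m + 1) := by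
    rw [ENNReal.ofReal_add (by positivity) (by positivity)]; simp
  rw [this, ← ENNReal.ofReal_coe_nnreal, ← ENNReal.ofReal_mul (by positivity),
    ← ENNReal.ofReal_mul (by positivity)]
  congr 1
  rw [Nat.factorial_succ]
  push_cast
  field_simp
  ring

lemma measurable_sum_range_of_measurable {N : Ω → ℕ} {Z : ℕ → Ω → ℝ≥0∞} (hN : Measurable N)
    (hZ : ∀ i, Measurable (Z i)) : Measurable fun ω => ∑ i ∈ Finset.range (N ω), Z i ω := by
  have : Measurable fun p : ℕ × Ω => ∑ i ∈ Finset.range p.1, Z i p.2 :=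
    measurable_from_prod_countable_right fun m =>
      Finset.measurable_fun_sum (Finset.range m) fun i _ => hZ i
  exact this.comp (hN.prodMk measurable_id)

lemma coeff_momentSeries_poissonSum {N : Ω → ℕ} {Z : ℕ → Ω → ℝ≥0∞} {r : ℝ≥0}
    (hN : Measurable N) (hZ : ∀ i, Measurable (Z i)) (hlaw : P.map N = poissonMeasure r)
    (hNZ : ∀ m, IndepFun N (fun ω => ∑ i ∈ Finset.range m, Z i ω) P) (n : ℕ) :
    PowerSeries.coeff n (momentSeries P fun ω => ∑ i ∈ Finset.range (N ω), Z i ω)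
      = ∑' m, poissonMeasure r {m} *
        PowerSeries.coeff n (momentSeries P fun ω => ∑ i ∈ Finset.range m, Z i ω) := by
  simp_rw [coeff_momentSeries, ← mul_assoc]
  rw [ENNReal.tsum_mul_right]
  congr 1
  -- Splitting over the value of `N` replaces the random number of summands by fixed ones, to which
  -- independence from `N` applies.
  have h1 : ∀ ω, (∑ i ∈ Finset.range (N ω), Z i ω) ^ n
      = ∑' m, (({m} : Set ℕ).indicator (fun _ => (1 : ℝ≥0∞)) (N ω)) *
        (∑ i ∈ Finset.range m, Z i ω) ^ n := by
    intro ω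
    rw [tsum_eq_single (N ω)]
    · simp
    · intro m hm
      simp [Set.indicator, hm.symm]
  simp_rw [h1]
  have hind : ∀ m, Measurable (({m} : Set ℕ).indicator fun _ => (1 : ℝ≥0∞)) :=
    fun m => measurable_of_countable _
  rw [lintegral_tsum fun m => by
    exact (((hind m).comp hN).mul (by fun_prop)).aemeasurable]
  refine tsum_congr fun m => ?_
  have hi := lintegral_mul_eq_lintegral_mul_lintegral_of_indepFun ((hind m).comp hN)
    (g := fun ω => (∑ i ∈ Finset.range m, Z i ω) ^ n) (by fun_prop)
    ((hNZ m).comp (hind m) (measurable_id.pow_const n))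
  refine hi.trans ?_
  congr 1
  rw [← hlaw, ← lintegral_indicator_one (measurableSet_singleton m)]
  exact (lintegral_map (hind m) hN).symm

/-- The differential equation satisfied by the moment series of a compound Poisson variable. -/
lemma derivative_momentSeries_poissonSum [IsProbabilityMeasure P] {N : Ω → ℕ}
    {Z : ℕ → Ω → ℝ≥0∞} {r : ℝ≥0} {φ : PowerSeries ℝ≥0∞}
    (hN : Measurable N) (hZ : ∀ i, Measurable (Z i)) (hlaw : P.map N = poissonMeasure r)
    (hNZ : ∀ m, IndepFun N (fun ω => ∑ i ∈ Finset.range m, Z i ω) P)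
    (hφ : ∀ i, momentSeries P (Z i) = φ)
    (h : ∀ m, IndepFun (fun ω => ∑ i ∈ Finset.range m, Z i ω) (Z m) P) :
    PowerSeries.derivative ℝ≥0∞ (momentSeries P fun ω => ∑ i ∈ Finset.range (N ω), Z i ω)
      = (r : ℝ≥0∞) • PowerSeries.derivative ℝ≥0∞ φ *
        momentSeries P fun ω => ∑ i ∈ Finset.range (N ω), Z i ω := by
  ext n
  have hc : ∀ n, PowerSeries.coeff n (momentSeries P fun ω => ∑ i ∈ Finset.range (N ω), Z i ω)
      = ∑' m, poissonMeasure r {m} * PowerSeries.coeff n (φ ^ m) := fun n => by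
    rw [coeff_momentSeries_poissonSum hN hZ hlaw hNZ]
    simp_rw [momentSeries_sum_range hZ hφ h]
  rw [PowerSeries.coeff_derivative, hc, ← ENNReal.tsum_mul_right]
  simp_rw [mul_assoc]
  have h1 : ∀ m : ℕ, PowerSeries.coeff (n + 1) (φ ^ m) * ((n : ℝ≥0∞) + 1)
      = m * PowerSeries.coeff n (φ ^ (m - 1) * PowerSeries.derivative ℝ≥0∞ φ) := fun m => by
    rw [← PowerSeries.coeff_derivative, PowerSeries.derivative_pow, mul_assoc,
      ← nsmul_eq_mul, map_nsmul, nsmul_eq_mul]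
  simp_rw [h1]
  -- The term `m = 0` carries the factor `m` and vanishes; the shift then allows the Poisson
  -- recursion to be used.
  rw [tsum_eq_zero_add' ENNReal.summable]
  simp only [Nat.cast_zero, zero_mul, mul_zero, zero_add, Nat.add_sub_cancel]
  have h2 : ∀ m : ℕ, poissonMeasure r {m + 1} * (((m + 1 : ℕ) : ℝ≥0∞) *
      PowerSeries.coeff n (φ ^ m * PowerSeries.derivative ℝ≥0∞ φ))
      = r * ∑ p ∈ Finset.HasAntidiagonal.antidiagonal n, poissonMeasure r {m} *
        (PowerSeries.coeff p.1 (φ ^ m) * PowerSeries.coeff p.2 (PowerSeries.derivative ℝ≥0∞ φ)) := by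
    intro m
    rw [PowerSeries.coeff_mul, ← Finset.mul_sum, ← mul_assoc, ← mul_assoc,
      ← succ_mul_poissonMeasure]
    push_cast
    ring
  simp_rw [h2]
  rw [ENNReal.tsum_mul_left, Summable.tsum_finsetSum fun _ _ => ENNReal.summable,
    smul_mul_assoc, PowerSeries.coeff_smul, smul_eq_mul, mul_comm (PowerSeries.derivative _ φ),
    PowerSeries.coeff_mul]
  congr 1
  refine Finset.sum_congr rfl fun p _ => ?_
  simp_rw [← mul_assoc]
  rw [ENNReal.tsum_mul_right, hc]

end MomentSeries

/-! ### Bell polynomials -/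

section Bell

/-- The complete Bell polynomials, graded by the number of blocks: if a compound Poisson variable of
rate `r` has cumulants `r * a 0, r * a 1, …`, then its `n`-th moment is
`(bell a n).eval r`. -/
noncomputable def bell (a : ℕ → ℝ≥0∞) : ℕ → Polynomial ℝ≥0∞
  | 0 => 1
  | n + 1 => Polynomial.X * ∑ i : Fin (n + 1), Polynomial.C (n.choose i * a (n - i)) * bell a i

variable (a : ℕ → ℝ≥0∞)

lemma bell_zero : bell a 0 = 1 := by rw [bell]

lemma bell_succ (n : ℕ) : bell a (n + 1) =
    Polynomial.X * ∑ i : Fin (n + 1), Polynomial.C (n.choose i * a (n - i)) * bell a i := by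
  rw [bell]

lemma eval_bell_succ (n : ℕ) (r : ℝ≥0∞) : (bell a (n + 1)).eval r =
    r * ∑ i : Fin (n + 1), n.choose i * a (n - i) * (bell a i).eval r := by
  simp [bell_succ, Polynomial.eval_finsetSum]

lemma coeff_bell_succ_zero (n : ℕ) : (bell a (n + 1)).coeff 0 = 0 := by
  simp [bell_succ]

lemma coeff_bell_succ_succ (n j : ℕ) : (bell a (n + 1)).coeff (j + 1) =
    ∑ i : Fin (n + 1), n.choose i * a (n - i) * (bell a i).coeff j := by
  simp only [bell_succ, Polynomial.coeff_X_mul, Polynomial.finsetSum_coeff,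
    Polynomial.coeff_C_mul]

lemma coeff_bell_eq_zero {n j : ℕ} (h : n < j) : (bell a n).coeff j = 0 := by
  induction n using Nat.strong_induction_on generalizing j with
  | _ n ih =>
    obtain ⟨j, rfl⟩ : ∃ k, j = k + 1 := ⟨j - 1, by omega⟩
    rcases n with _ | n
    · simp [bell_zero, Polynomial.coeff_one]
    · rw [coeff_bell_succ_succ]
      exact Finset.sum_eq_zero fun i _ => by rw [ih i (by omega) (by omega), mul_zero]

/-- For degree reasons only the summand `i = n` of the recursion reaches the top degree, and it
contributes a factor `a 0`. -/
lemma coeff_bell_self (n : ℕ) : (bell a n).coeff n = a 0 ^ n := by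
  induction n with
  | zero => simp [bell_zero]
  | succ n ih =>
    rw [coeff_bell_succ_succ, Finset.sum_eq_single (Fin.last n)]
    · simp [ih, pow_succ']
    · intro i _ hi
      rw [coeff_bell_eq_zero, mul_zero]
      exact Fin.val_lt_last hi
    · simp

lemma eval_bell (n : ℕ) (r : ℝ≥0∞) :
    (bell a n).eval r = ∑ j ∈ Finset.range (n + 1), (bell a n).coeff j * r ^ j :=
  Polynomial.eval_eq_sum_range' (Nat.lt_succ_of_le
    (Polynomial.natDegree_le_iff_coeff_eq_zero.2 fun _ h => coeff_bell_eq_zero a h)) r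

/-- The constant does not depend on `a`, so the bound can be integrated over random `a`. The
condition `1 ≤ s` lets lower powers of `s` be absorbed into `s ^ n`. -/
lemma exists_coeff_bell_le (n : ℕ) : ∃ K : ℕ, ∀ (a : ℕ → ℝ≥0∞) (s : ℝ≥0∞), 1 ≤ s →
    (∀ i, a i ≤ s) → ∀ j, (bell a n).coeff j ≤ K * s ^ n := by
  induction n using Nat.strong_induction_on with
  | _ n ih =>
    rcases n with _ | n
    · refine ⟨1, fun a s _ _ j => ?_⟩
      rw [bell_zero, Polynomial.coeff_one]
      split_ifs <;> simp
    · choose K hK using ih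
      refine ⟨∑ i : Fin (n + 1), n.choose i * K i (by omega), fun a s hs ha j => ?_⟩
      rcases j with _ | j
      · simp [coeff_bell_succ_zero]
      · rw [coeff_bell_succ_succ]
        push_cast
        rw [Finset.sum_mul]
        refine Finset.sum_le_sum fun i _ => ?_
        calc (n.choose i : ℝ≥0∞) * a (n - i) * (bell a i).coeff j
            ≤ n.choose i * s * (K i (by omega) * s ^ (i : ℕ)) := by
              gcongr
              · exact ha _
              · exact hK i (by omega) a s hs ha j
          _ = n.choose i * K i (by omega) * s ^ ((i : ℕ) + 1) := by ring
          _ ≤ n.choose i * K i (by omega) * s ^ (n + 1) := by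
              gcongr
              omega

lemma measurable_coeff_bell {Ω : Type*} [MeasurableSpace Ω] {a : Ω → ℕ → ℝ≥0∞}
    (ha : ∀ i, Measurable fun ω => a ω i) (n j : ℕ) :
    Measurable fun ω => (bell (a ω) n).coeff j := by
  induction n using Nat.strong_induction_on generalizing j with
  | _ n ih =>
    rcases n with _ | n
    · simp [bell_zero]
    · rcases j with _ | j
      · simp [coeff_bell_succ_zero]
      · simp_rw [coeff_bell_succ_succ]
        exact Finset.measurable_fun_sum _ fun i _ =>
          ((ha _).const_mul _).mul (ih i (by omega) j)

lemma eval_bell_ne_top {a : ℕ → ℝ≥0∞} (ha : ∀ i, a i ≠ ∞) {r : ℝ≥0∞} (hr : r ≠ ∞) (n : ℕ) :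
    (bell a n).eval r ≠ ∞ := by
  induction n using Nat.strong_induction_on with
  | _ n ih =>
    rcases n with _ | n
    · simp [bell_zero]
    · rw [eval_bell_succ]
      exact ENNReal.mul_ne_top hr (ENNReal.sum_ne_top.2 fun i _ =>
        ENNReal.mul_ne_top (ENNReal.mul_ne_top (ENNReal.natCast_ne_top _) (ha _))
          (ih i (by omega)))

/-- Finiteness of the limits matters: multiplication on `[0, ∞]` is discontinuous at `(0, ∞)`. -/
lemma tendsto_eval_bell {ι : Type*} {l : Filter ι} {b : ι → ℕ → ℝ≥0∞} {a : ℕ → ℝ≥0∞}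
    (h : ∀ i, Filter.Tendsto (fun K => b K i) l (nhds (a i)))
    (ha : ∀ i, a i ≠ ∞) {r : ℝ≥0∞} (hr : r ≠ ∞) (n : ℕ) :
    Filter.Tendsto (fun K => (bell (b K) n).eval r) l (nhds ((bell a n).eval r)) := by
  induction n using Nat.strong_induction_on with
  | _ n ih =>
    rcases n with _ | n
    · simp [bell_zero, tendsto_const_nhds]
    · simp_rw [eval_bell_succ]
      refine ENNReal.Tendsto.const_mul (tendsto_finsetSum _ fun i _ => ?_) (Or.inr hr)
      exact ENNReal.Tendsto.mul
        (ENNReal.Tendsto.const_mul (h _) (Or.inr (ENNReal.natCast_ne_top _)))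
        (Or.inr (eval_bell_ne_top ha hr i)) (ih i (by omega))
        (Or.inr (ENNReal.mul_ne_top (ENNReal.natCast_ne_top _) (ha _)))

end Bell

/-! ### From the differential equation to moments -/

section CompoundPoisson

variable {Ω : Type*} [MeasurableSpace Ω] {P : Measure Ω}

/-- If the moment series solves the differential equation of a compound Poisson variable, then the
moments are given by Bell polynomials. -/
lemma lintegral_pow_eq_eval_bell [IsProbabilityMeasure P] {X : Ω → ℝ≥0∞} {r : ℝ≥0∞}
    {a : ℕ → ℝ≥0∞}
    (h : PowerSeries.derivative ℝ≥0∞ (momentSeries P X)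
      = r • PowerSeries.mk (fun n => a n * (n.factorial : ℝ≥0∞)⁻¹) * momentSeries P X) (n : ℕ) :
    ∫⁻ ω, X ω ^ n ∂P = (bell a n).eval r := by
  induction n using Nat.strong_induction_on with
  | _ n ih =>
    rcases n with _ | n
    · simp [bell_zero]
    · have h0 : ∀ m : ℕ, (m.factorial : ℝ≥0∞) ≠ 0 := fun m => by
        exact_mod_cast m.factorial_ne_zero
      have ht : ∀ m : ℕ, (m.factorial : ℝ≥0∞) ≠ ∞ := fun m => ENNReal.natCast_ne_top _
      -- The coefficient of order `n` of the equation, multiplied by `n!`, is the recursion that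
      -- defines `bell`.
      have h1 := congrArg (fun F => PowerSeries.coeff n F * (n.factorial : ℝ≥0∞)) h
      rw [PowerSeries.coeff_derivative, coeff_momentSeries, mul_assoc, mul_assoc] at h1
      have h2 : ((n + 1).factorial : ℝ≥0∞)⁻¹ * (((n : ℝ≥0∞) + 1) * n.factorial) = 1 := by
        have h3 : ((n : ℝ≥0∞) + 1) * n.factorial = ((n + 1).factorial : ℝ≥0∞) := by
          rw [Nat.factorial_succ]
          push_cast
          rfl
        rw [h3, ENNReal.inv_mul_cancel (h0 (n + 1)) (ht (n + 1))]
      rw [h2, mul_one] at h1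
      rw [h1, eval_bell_succ, smul_mul_assoc, PowerSeries.coeff_smul, smul_eq_mul, mul_assoc,
        PowerSeries.coeff_mul, Finset.Nat.sum_antidiagonal_eq_sum_range_succ_mk,
        ← Finset.sum_range_reflect, Finset.sum_mul, ← Fin.sum_univ_eq_sum_range
          (fun i => PowerSeries.coeff (n + 1 - 1 - i, n - (n + 1 - 1 - i)).1 _ *
            PowerSeries.coeff (n + 1 - 1 - i, n - (n + 1 - 1 - i)).2 (momentSeries P X) *
              (n.factorial : ℝ≥0∞))]
      congr 1
      refine Finset.sum_congr rfl fun i _ => ?_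
      have hi : n - (n - (i : ℕ)) = i := by omega
      simp only [Nat.add_sub_cancel, hi, PowerSeries.coeff_mk, coeff_momentSeries,
        ih i i.2]
      have h3 := choose_mul_inv_factorial (n := n) (i := i) (j := n - i) (by omega)
      calc a (n - i) * ((n - (i : ℕ)).factorial : ℝ≥0∞)⁻¹ *
            ((bell a i).eval r * ((i : ℕ).factorial : ℝ≥0∞)⁻¹) * n.factorial
          = a (n - i) * (bell a i).eval r * ((((i : ℕ).factorial : ℝ≥0∞)⁻¹ *
            ((n - (i : ℕ)).factorial : ℝ≥0∞)⁻¹) * n.factorial) := by ring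
        _ = _ := by
          rw [← h3, mul_assoc (n.choose i : ℝ≥0∞), ENNReal.inv_mul_cancel (h0 n) (ht n)]
          ring

lemma derivative_momentSeries (X : Ω → ℝ≥0∞) :
    PowerSeries.derivative ℝ≥0∞ (momentSeries P X) =
      PowerSeries.mk fun n => (∫⁻ ω, X ω ^ (n + 1) ∂P) * (n.factorial : ℝ≥0∞)⁻¹ := by
  ext n
  rw [PowerSeries.coeff_derivative, coeff_momentSeries, PowerSeries.coeff_mk, mul_assoc,
    Nat.factorial_succ]
  congr 1
  push_cast
  rw [ENNReal.mul_inv (Or.inl (by simp)) (Or.inl (by simp)), mul_right_comm,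
    ENNReal.inv_mul_cancel (by simp) (by simp), one_mul]

/-- Series of independent sums multiply, so by the Leibniz rule their logarithmic derivatives `ψ k`
add. -/
lemma derivative_momentSeries_sum [IsProbabilityMeasure P] {T : ℕ → Ω → ℝ≥0∞}
    {ψ : ℕ → PowerSeries ℝ≥0∞} (hT : ∀ k, Measurable (T k))
    (h : ∀ k, PowerSeries.derivative ℝ≥0∞ (momentSeries P (T k)) = ψ k * momentSeries P (T k))
    (hind : ∀ m, IndepFun (fun ω => ∑ k ∈ Finset.range m, T k ω) (T m) P) (m : ℕ) :
    PowerSeries.derivative ℝ≥0∞ (momentSeries P fun ω => ∑ k ∈ Finset.range m, T k ω)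
      = (∑ k ∈ Finset.range m, ψ k) *
        momentSeries P fun ω => ∑ k ∈ Finset.range m, T k ω := by
  induction m with
  | zero => simp [momentSeries_zero]
  | succ m ih =>
    simp_rw [Finset.sum_range_succ]
    rw [momentSeries_add (by fun_prop) (hT m) (hind m), Derivation.leibniz, ih, h, smul_eq_mul,
      smul_eq_mul]
    ring

/-- Moments of an infinite sum of independent compound Poisson variables. -/
lemma lintegral_tsum_pow_eq_eval_bell [IsProbabilityMeasure P] {T : ℕ → Ω → ℝ≥0∞} {r : ℝ≥0}
    {a : ℕ → ℕ → ℝ≥0∞} (hT : ∀ k, Measurable (T k))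
    (h : ∀ k, PowerSeries.derivative ℝ≥0∞ (momentSeries P (T k)) =
      (r : ℝ≥0∞) • PowerSeries.mk (fun n => a k n * (n.factorial : ℝ≥0∞)⁻¹) *
        momentSeries P (T k))
    (hind : ∀ m, IndepFun (fun ω => ∑ k ∈ Finset.range m, T k ω) (T m) P)
    (ha : ∀ n, ∑' k, a k n ≠ ∞) (n : ℕ) :
    ∫⁻ ω, (∑' k, T k ω) ^ n ∂P = (bell (fun n => ∑' k, a k n) n).eval (r : ℝ≥0∞) := by
  have h1 : ∀ m, ∫⁻ ω, (∑ k ∈ Finset.range m, T k ω) ^ n ∂P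
      = (bell (fun n => ∑ k ∈ Finset.range m, a k n) n).eval (r : ℝ≥0∞) := fun m => by
    refine lintegral_pow_eq_eval_bell ?_ n
    rw [derivative_momentSeries_sum hT h hind, ← Finset.smul_sum]
    congr 2
    ext n
    simp [Finset.sum_mul]
  have h2 : Filter.Tendsto (fun m => ∫⁻ ω, (∑ k ∈ Finset.range m, T k ω) ^ n ∂P) Filter.atTop
      (nhds (∫⁻ ω, (∑' k, T k ω) ^ n ∂P)) := by
    refine lintegral_tendsto_of_tendsto_of_monotone (fun m => by fun_prop) ?_ ?_
    · refine Filter.Eventually.of_forall fun ω m m' hm => ?_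
      have := Finset.sum_le_sum_of_subset (f := fun k => T k ω) (Finset.range_mono hm)
      simp only
      gcongr
    · exact Filter.Eventually.of_forall fun ω =>
        ((ENNReal.continuous_pow n).tendsto _).comp ENNReal.summable.hasSum.tendsto_sum_nat
  refine tendsto_nhds_unique h2 ?_
  simp_rw [h1]
  exact tendsto_eval_bell (fun i => ENNReal.summable.hasSum.tendsto_sum_nat) ha
    ENNReal.coe_ne_top n

end CompoundPoisson

/-! ### The interval splitting and the distance to the cut -/

section Geometry

variable {u : ℕ → ℕ → ℝ}

lemma Y_zero_zero (u : ℕ → ℕ → ℝ) : Y u 0 0 = 0 := by simp [Y]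

lemma Y_zero_one (u : ℕ → ℕ → ℝ) : Y u 0 1 = 1 := by simp [Y]

lemma Y_succ_even (u : ℕ → ℕ → ℝ) (k i : ℕ) : Y u (k + 1) (2 * i) = Y u k i := by
  simp [Y]

lemma Y_succ_odd (u : ℕ → ℕ → ℝ) (k i : ℕ) : Y u (k + 1) (2 * i + 1) =
    (1 - u k (i + 1)) * Y u k i + u k (i + 1) * Y u k (i + 1) := by
  have h1 : (2 * i + 1) / 2 = i := by omega
  have h2 : ¬ Even (2 * i + 1) := by simp
  rw [Y, if_neg h2, h1]

lemma Y_left (u : ℕ → ℕ → ℝ) (k : ℕ) : Y u k 0 = 0 := by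
  induction k with
  | zero => exact Y_zero_zero u
  | succ k ih => exact (Y_succ_even u k 0).trans ih

lemma Y_right (u : ℕ → ℕ → ℝ) (k : ℕ) : Y u k (2 ^ k) = 1 := by
  induction k with
  | zero => exact Y_zero_one u
  | succ k ih => rw [pow_succ', Y_succ_even, ih]

/-- Entries outside `SplitIndex` are arbitrary in the model and 0 in `toArray`; this makes the two
interchangeable. -/
lemma Y_congr {u u' : ℕ → ℕ → ℝ} (h : ∀ q : SplitIndex, u q.1.1 q.1.2 = u' q.1.1 q.1.2)
    {k j : ℕ} (hj : j ≤ 2 ^ k) : Y u k j = Y u' k j := by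
  induction k generalizing j with
  | zero => simp [Y]
  | succ k ih =>
    rw [pow_succ'] at hj
    obtain ⟨i, rfl | rfl⟩ := Nat.even_or_odd' j
    · rw [Y_succ_even, Y_succ_even, ih (by omega)]
    · rw [Y_succ_odd, Y_succ_odd, ih (by omega), ih (by omega),
        h ⟨(k, i + 1), by simp, by simp only; omega⟩]

/-- All the split ratios that matter lie in `[0, 1]`. -/
def UnitRatios (u : ℕ → ℕ → ℝ) : Prop := ∀ q : SplitIndex, u q.1.1 q.1.2 ∈ Set.Icc (0 : ℝ) 1

lemma UnitRatios.mem (hu : UnitRatios u) {k j : ℕ} (hj : j < 2 ^ k) :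
    u k (j + 1) ∈ Set.Icc (0 : ℝ) 1 :=
  hu ⟨(k, j + 1), by simp, by simp only; omega⟩

lemma Y_le_Y_succ (hu : UnitRatios u) {k j : ℕ} (hj : j < 2 ^ k) : Y u k j ≤ Y u k (j + 1) := by
  induction k generalizing j with
  | zero =>
    obtain rfl : j = 0 := by simpa using hj
    simp [Y]
  | succ k ih =>
    rw [pow_succ'] at hj
    obtain ⟨i, rfl | rfl⟩ := Nat.even_or_odd' j
    · have h1 := ih (j := i) (by omega)
      have h2 := hu.mem (k := k) (j := i) (by omega)
      rw [Y_succ_even, Y_succ_odd]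
      nlinarith [h2.1, h2.2, mul_nonneg h2.1 (sub_nonneg.2 h1)]
    · have h1 := ih (j := i) (by omega)
      have h2 := hu.mem (k := k) (j := i) (by omega)
      rw [show 2 * i + 1 + 1 = 2 * (i + 1) by ring, Y_succ_even, Y_succ_odd]
      nlinarith [h2.1, h2.2, mul_nonneg (sub_nonneg.2 h2.2) (sub_nonneg.2 h1)]

lemma Y_mono (hu : UnitRatios u) {k i j : ℕ} (hij : i ≤ j) (hj : j ≤ 2 ^ k) :
    Y u k i ≤ Y u k j := by
  induction j, hij using Nat.le_induction with
  | base => exact le_rfl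
  | succ j _ ih => exact (ih (by omega)).trans (Y_le_Y_succ hu (by omega))

lemma Y_mem_Icc (hu : UnitRatios u) {k j : ℕ} (hj : j ≤ 2 ^ k) : Y u k j ∈ Set.Icc (0 : ℝ) 1 :=
  ⟨Y_left u k ▸ Y_mono hu (Nat.zero_le j) hj, Y_right u k ▸ Y_mono hu hj le_rfl⟩

lemma Y_le_cut (hu : UnitRatios u) {k j : ℕ} (hj : j < 2 ^ k) :
    Y u k j ≤ Y u (k + 1) (2 * j + 1) :=
  Y_succ_even u k j ▸ Y_le_Y_succ hu (by rw [pow_succ']; omega)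

lemma cut_le_Y (hu : UnitRatios u) {k j : ℕ} (hj : j < 2 ^ k) :
    Y u (k + 1) (2 * j + 1) ≤ Y u k (j + 1) :=
  Y_succ_even u k (j + 1) ▸ Y_le_Y_succ hu (by rw [pow_succ']; omega)

/-- Descend from parent to child by comparing `x` with the cut. No restriction on the ratios is
needed; only uniqueness of the interval uses monotonicity. -/
lemma exists_mem_Ico_Y (u : ℕ → ℕ → ℝ) (k : ℕ) {x : ℝ} (hx : x ∈ Set.Ico (0 : ℝ) 1) :
    ∃ j < 2 ^ k, x ∈ Set.Ico (Y u k j) (Y u k (j + 1)) := by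
  induction k with
  | zero => exact ⟨0, by simp, by simpa [Y] using hx⟩
  | succ k ih =>
    obtain ⟨j, hj, h1, h2⟩ := ih
    rcases lt_or_ge x (Y u (k + 1) (2 * j + 1)) with h | h
    · exact ⟨2 * j, by rw [pow_succ']; omega, by rwa [Y_succ_even], h⟩
    · exact ⟨2 * j + 1, by rw [pow_succ']; omega, h,
        by rwa [show 2 * j + 1 + 1 = 2 * (j + 1) by ring, Y_succ_even]⟩

lemma eq_of_mem_Ico_Y (hu : UnitRatios u) {k i j : ℕ} (hi : i < 2 ^ k) (hj : j < 2 ^ k) {x : ℝ}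
    (hxi : x ∈ Set.Ico (Y u k i) (Y u k (i + 1))) (hxj : x ∈ Set.Ico (Y u k j) (Y u k (j + 1))) :
    i = j := by
  rcases lt_trichotomy i j with h | h | h
  · exact absurd (hxi.2.trans_le ((Y_mono hu h hj.le).trans hxj.1)) (lt_irrefl x)
  · exact h
  · exact absurd (hxj.2.trans_le ((Y_mono hu h hi.le).trans hxi.1)) (lt_irrefl x)

/-- The distance from `x` to the point at which its interval of generation `k` is cut, written so
that it is visibly measurable in all the variables. -/
noncomputable def cutGap (u : ℕ → ℕ → ℝ) (k : ℕ) (x : ℝ) : ℝ≥0∞ :=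
  ∑ j ∈ Finset.range (2 ^ k), (Set.Ico (Y u k j) (Y u k (j + 1))).indicator
    (fun x => ENNReal.ofReal |x - Y u (k + 1) (2 * j + 1)|) x

lemma cutGap_congr {u u' : ℕ → ℕ → ℝ} (h : ∀ q : SplitIndex, u q.1.1 q.1.2 = u' q.1.1 q.1.2)
    (k : ℕ) (x : ℝ) : cutGap u k x = cutGap u' k x := by
  refine Finset.sum_congr rfl fun j hj => ?_
  have hj := Finset.mem_range.1 hj
  rw [Y_congr h hj.le, Y_congr h (Nat.succ_le_of_lt hj),
    Y_congr h (k := k + 1) (by rw [pow_succ']; omega)]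

lemma cutGap_eq (hu : UnitRatios u) {k j : ℕ} (hj : j < 2 ^ k) {x : ℝ}
    (hx : x ∈ Set.Ico (Y u k j) (Y u k (j + 1))) :
    cutGap u k x = ENNReal.ofReal |x - Y u (k + 1) (2 * j + 1)| := by
  rw [cutGap, Finset.sum_eq_single j, Set.indicator_of_mem hx]
  · intro i hi hij
    exact Set.indicator_of_notMem (fun h => hij
      (eq_of_mem_Ico_Y hu (Finset.mem_range.1 hi) hj h hx)) _
  · exact fun h => absurd (Finset.mem_range.2 hj) h

lemma J_eq (hu : UnitRatios u) {k j : ℕ} (hj : j < 2 ^ k) {x : ℝ}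
    (hx : x ∈ Set.Ico (Y u k j) (Y u k (j + 1))) : J u k.succPNat x = 2 * j + 1 := by
  have h : {i : ℕ | 1 ≤ i ∧ i ≤ 2 ^ ((k.succPNat : ℕ) - 1) ∧
      Y u ((k.succPNat : ℕ) - 1) (i - 1) ≤ x ∧ x < Y u ((k.succPNat : ℕ) - 1) i} = {j + 1} := by
    ext i
    simp only [Nat.succPNat_coe, Nat.succ_eq_add_one, Nat.add_sub_cancel, Set.mem_ofPred_eq,
      Set.mem_singleton_iff]
    constructor
    · rintro ⟨h1, h2, h3, h4⟩
      obtain ⟨i, rfl⟩ : ∃ m, i = m + 1 := ⟨i - 1, by omega⟩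
      have := eq_of_mem_Ico_Y hu (by omega) hj ⟨h3, h4⟩ hx
      omega
    · rintro rfl
      exact ⟨by omega, by omega, hx.1, hx.2⟩
  rw [J, h, csInf_singleton]
  omega

lemma ofReal_cutDist (hu : UnitRatios u) (k : ℕ) {x : ℝ} (hx : x ∈ Set.Ico (0 : ℝ) 1) :
    ENNReal.ofReal (cutDist u (k.succPNat, x)) = cutGap u k x := by
  obtain ⟨j, hj, hxj⟩ := exists_mem_Ico_Y u k hx
  rw [cutGap_eq hu hj hxj, cutDist, J_eq hu hj hxj]
  rfl

lemma cutGap_le_one (hu : UnitRatios u) (k : ℕ) {x : ℝ} (hx : x ∈ Set.Ico (0 : ℝ) 1) :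
    cutGap u k x ≤ 1 := by
  obtain ⟨j, hj, hxj⟩ := exists_mem_Ico_Y u k hx
  have h := Y_mem_Icc hu (k := k + 1) (j := 2 * j + 1) (by rw [pow_succ']; omega)
  rw [cutGap_eq hu hj hxj, ← ENNReal.ofReal_one]
  refine ENNReal.ofReal_le_ofReal (abs_le.2 ⟨?_, ?_⟩) <;> linarith [h.1, h.2, hx.1, hx.2]

/-- The cut lies in the same interval as `x`, so their distance is at most its length. -/
lemma cutGap_le_sum (hu : UnitRatios u) (k : ℕ) (x : ℝ) :
    cutGap u k x ≤ ∑ j ∈ Finset.range (2 ^ k), (Set.Ico (Y u k j) (Y u k (j + 1))).indicator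
      (fun _ => ENNReal.ofReal (Y u k (j + 1) - Y u k j)) x := by
  refine Finset.sum_le_sum fun j hj => ?_
  have hj := Finset.mem_range.1 hj
  by_cases hx : x ∈ Set.Ico (Y u k j) (Y u k (j + 1))
  · rw [Set.indicator_of_mem hx, Set.indicator_of_mem hx]
    have h1 := Y_le_cut hu hj
    have h2 := cut_le_Y hu hj
    refine ENNReal.ofReal_le_ofReal (abs_le.2 ⟨?_, ?_⟩) <;> linarith [hx.1, hx.2]
  · rw [Set.indicator_of_notMem hx, Set.indicator_of_notMem hx]

lemma lintegral_cutGap_le (hu : UnitRatios u) (k : ℕ) :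
    ∫⁻ x in Set.Icc (0 : ℝ) 1, cutGap u k x ≤
      ∑ j ∈ Finset.range (2 ^ k), ENNReal.ofReal (Y u k (j + 1) - Y u k j) ^ 2 := by
  calc ∫⁻ x in Set.Icc (0 : ℝ) 1, cutGap u k x
      ≤ ∫⁻ x, ∑ j ∈ Finset.range (2 ^ k), (Set.Ico (Y u k j) (Y u k (j + 1))).indicator
          (fun _ => ENNReal.ofReal (Y u k (j + 1) - Y u k j)) x :=
        (lintegral_mono (cutGap_le_sum hu k)).trans (setLIntegral_le_lintegral _ _)
    _ = _ := by
        rw [lintegral_finsetSum _ fun j _ => measurable_const.indicator measurableSet_Ico]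
        refine Finset.sum_congr rfl fun j _ => ?_
        rw [lintegral_indicator measurableSet_Ico, setLIntegral_const, Real.volume_Ico, sq]

lemma ae_restrict_Icc_mem_Ico : ∀ᵐ x ∂(volume.restrict (Set.Icc (0 : ℝ) 1)),
    x ∈ Set.Ico (0 : ℝ) 1 := by
  rw [← restrict_Ico_eq_restrict_Icc]
  exact ae_restrict_mem measurableSet_Ico

instance isProbabilityMeasure_restrict_Icc_zero_one :
    IsProbabilityMeasure (volume.restrict (Set.Icc (0 : ℝ) 1)) :=
  ⟨by simp⟩

lemma lintegral_cutGap_le_one (hu : UnitRatios u) (k : ℕ) :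
    ∫⁻ x in Set.Icc (0 : ℝ) 1, cutGap u k x ≤ 1 := by
  calc ∫⁻ x in Set.Icc (0 : ℝ) 1, cutGap u k x ≤ ∫⁻ x in Set.Icc (0 : ℝ) 1, 1 :=
        lintegral_mono_ae (ae_restrict_Icc_mem_Ico.mono fun x hx => cutGap_le_one hu k hx)
    _ = 1 := by simp

lemma lintegral_cutGap_pow_le (hu : UnitRatios u) (k i : ℕ) :
    ∫⁻ x in Set.Icc (0 : ℝ) 1, cutGap u k x ^ (i + 1) ≤
      ∫⁻ x in Set.Icc (0 : ℝ) 1, cutGap u k x := by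
  refine lintegral_mono_ae (ae_restrict_Icc_mem_Ico.mono fun x hx => ?_)
  rw [pow_succ]
  exact mul_le_of_le_one_left' (pow_le_one' (cutGap_le_one hu k hx) i)

/-- In generation 0 the distance vanishes only at the single cut point, a null set. This is the
source of the nonzero leading coefficient. -/
lemma lintegral_cutGap_zero_pos (hu : UnitRatios u) :
    ∫⁻ x in Set.Icc (0 : ℝ) 1, cutGap u 0 x ≠ 0 := by
  have hm : Measurable (cutGap u 0) :=
    Finset.measurable_fun_sum _ fun j _ => Measurable.indicator (by fun_prop) measurableSet_Ico
  rw [Ne, lintegral_eq_zero_iff hm]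
  intro h
  have hne : ∀ᵐ x ∂(volume.restrict (Set.Icc (0 : ℝ) 1)), x ≠ Y u 1 1 :=
    ae_restrict_of_ae (Measure.ae_ne volume _)
  obtain ⟨x, h1, h2, h3⟩ := (h.and (hne.and ae_restrict_Icc_mem_Ico)).exists
  have hx : x ∈ Set.Ico (Y u 0 0) (Y u 0 (0 + 1)) := by simpa [Y] using h3
  rw [cutGap_eq hu (by simp) hx] at h1
  simp only [Pi.zero_apply, ENNReal.ofReal_eq_zero, abs_nonpos_iff, sub_eq_zero] at h1
  exact h2 h1

/-- The array of split ratios, extended by `0` to the irrelevant indices. -/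
noncomputable def toArray (v : SplitIndex → ℝ) (k j : ℕ) : ℝ :=
  if h : 1 ≤ j ∧ j ≤ 2 ^ k then v ⟨(k, j), h⟩ else 0

lemma toArray_apply (v : SplitIndex → ℝ) (q : SplitIndex) : toArray v q.1.1 q.1.2 = v q :=
  dif_pos q.2

lemma toArray_succ (v : SplitIndex → ℝ) {k j : ℕ} (hj : j < 2 ^ k) :
    toArray v k (j + 1) = v ⟨(k, j + 1), by simp, by simp only; omega⟩ :=
  dif_pos _

lemma unitRatios_toArray {v : SplitIndex → ℝ} (hv : ∀ q, v q ∈ Set.Icc (0 : ℝ) 1) :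
    UnitRatios (toArray v) := fun q => toArray_apply v q ▸ hv q

@[fun_prop]
lemma measurable_toArray (k j : ℕ) : Measurable fun v => toArray v k j := by
  unfold toArray
  split_ifs <;> fun_prop

@[fun_prop]
lemma measurable_Y_toArray (k j : ℕ) : Measurable fun v => Y (toArray v) k j := by
  induction k generalizing j with
  | zero => simp [Y]
  | succ k ih =>
    simp only [Y]
    split_ifs
    · exact ih _
    · have h1 := ih (j / 2)
      have h2 := ih (j / 2 + 1)
      fun_prop

lemma measurable_cutGap_toArray (k : ℕ) :
    Measurable fun p : (SplitIndex → ℝ) × ℝ => cutGap (toArray p.1) k p.2 := by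
  refine Finset.measurable_fun_sum _ fun j _ => ?_
  have hY : ∀ k j, Measurable fun p : (SplitIndex → ℝ) × ℝ => Y (toArray p.1) k j :=
    fun k j => (measurable_Y_toArray k j).comp measurable_fst
  have h1 := hY k j
  have h2 := hY k (j + 1)
  have h3 := hY (k + 1) (2 * j + 1)
  have hs : MeasurableSet {p : (SplitIndex → ℝ) × ℝ |
      p.2 ∈ Set.Ico (Y (toArray p.1) k j) (Y (toArray p.1) k (j + 1))} :=
    (measurableSet_le h1 measurable_snd).inter (measurableSet_lt measurable_snd h2)
  have hf : Measurable fun p : (SplitIndex → ℝ) × ℝ =>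
      ENNReal.ofReal |p.2 - Y (toArray p.1) (k + 1) (2 * j + 1)| :=
    (continuous_abs.measurable.comp (measurable_snd.sub h3)).ennreal_ofReal
  exact hf.indicator hs

/-- The rescaled cumulants of the total cut distance, given the split ratios. -/
noncomputable def cutCumulant (v : SplitIndex → ℝ) (n : ℕ) : ℝ≥0∞ :=
  ∑' k, ∫⁻ x in Set.Icc (0 : ℝ) 1, cutGap (toArray v) k x ^ (n + 1)

lemma measurable_cutCumulant (n : ℕ) : Measurable fun v => cutCumulant v n :=
  Measurable.tsum fun k =>
    ((measurable_cutGap_toArray k).pow_const (n + 1)).lintegral_prod_right'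

lemma cutCumulant_le {v : SplitIndex → ℝ} (hv : ∀ q, v q ∈ Set.Icc (0 : ℝ) 1) (n : ℕ) :
    cutCumulant v n ≤ cutCumulant v 0 := by
  refine ENNReal.tsum_le_tsum fun k => ?_
  simpa using lintegral_cutGap_pow_le (unitRatios_toArray hv) k n

lemma cutCumulant_zero_ne_zero {v : SplitIndex → ℝ} (hv : ∀ q, v q ∈ Set.Icc (0 : ℝ) 1) :
    cutCumulant v 0 ≠ 0 := by
  intro h
  refine lintegral_cutGap_zero_pos (unitRatios_toArray hv) ?_
  simpa using ENNReal.tsum_eq_zero.1 h 0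

end Geometry

/-- The uniform distribution on `[0, 1]`. -/
noncomputable abbrev uniform : Measure ℝ := volume.restrict (Set.Icc (0 : ℝ) 1)

/-- The joint law of the split ratios. -/
noncomputable abbrev splitLaw : Measure (SplitIndex → ℝ) := Measure.infinitePi fun _ => uniform

lemma ae_splitLaw_mem_Icc : ∀ᵐ v ∂splitLaw, ∀ q, v q ∈ Set.Icc (0 : ℝ) 1 := by
  refine ae_all_iff.2 fun q => ?_
  have h : splitLaw.map (fun v => v q) = uniform := Measure.infinitePi_map_eval _ q
  refine ae_of_ae_map (f := fun v : SplitIndex → ℝ => v q) (p := fun x => x ∈ Set.Icc (0 : ℝ) 1)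
    (measurable_pi_apply q).aemeasurable ?_
  rw [h]
  exact ae_restrict_mem measurableSet_Icc

/-! ### Second moments of interval lengths and moments of the cumulants -/

section Lengths

lemma lintegral_uniform_sq : ∫⁻ x, ENNReal.ofReal x ^ 2 ∂uniform = 3⁻¹ := by
  have h1 : ∫⁻ x, ENNReal.ofReal x ^ 2 ∂uniform = ∫⁻ x, ENNReal.ofReal (x ^ 2) ∂uniform :=
    lintegral_congr_ae ((ae_restrict_mem measurableSet_Icc).mono fun x hx =>
      (ENNReal.ofReal_pow hx.1 2).symm)
  rw [h1, ← ofReal_integral_eq_lintegral_ofReal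
    ((continuous_pow 2).integrableOn_Icc) (Filter.Eventually.of_forall fun x => sq_nonneg x),
    integral_Icc_eq_integral_Ioc, ← intervalIntegral.integral_of_le zero_le_one, integral_pow]
  norm_num
  rw [one_div, ENNReal.ofReal_inv_of_pos (by norm_num)]
  norm_num

lemma lintegral_uniform_one_sub_sq : ∫⁻ x, ENNReal.ofReal (1 - x) ^ 2 ∂uniform = 3⁻¹ := by
  have h1 : ∫⁻ x, ENNReal.ofReal (1 - x) ^ 2 ∂uniform =
      ∫⁻ x, ENNReal.ofReal ((1 - x) ^ 2) ∂uniform :=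
    lintegral_congr_ae ((ae_restrict_mem measurableSet_Icc).mono fun x hx =>
      (ENNReal.ofReal_pow (sub_nonneg.2 hx.2) 2).symm)
  rw [h1, ← ofReal_integral_eq_lintegral_ofReal
    (Continuous.integrableOn_Icc (by fun_prop))
    (Filter.Eventually.of_forall fun x => sq_nonneg (1 - x)),
    integral_Icc_eq_integral_Ioc, ← intervalIntegral.integral_of_le zero_le_one,
    intervalIntegral.integral_comp_sub_left (fun x : ℝ => x ^ 2), integral_pow]
  norm_num
  rw [one_div, ENNReal.ofReal_inv_of_pos (by norm_num)]
  norm_num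

/-- The points of generation `k` are determined by the ratios of the earlier generations. -/
lemma dependsOn_Y {k j : ℕ} (hj : j ≤ 2 ^ k) :
    DependsOn (fun v => Y (toArray v) k j) {q : SplitIndex | q.1.1 < k} := by
  intro v w h
  induction k generalizing j with
  | zero => simp [Y]
  | succ k ih =>
    have ih' : ∀ {j}, j ≤ 2 ^ k → Y (toArray v) k j = Y (toArray w) k j := fun hj =>
      ih hj fun q hq => h q (Nat.lt_succ_of_lt hq)
    rw [pow_succ'] at hj
    obtain ⟨i, rfl | rfl⟩ := Nat.even_or_odd' j
    · simp only [Y_succ_even]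
      exact ih' (by omega)
    · simp only [Y_succ_odd, toArray_succ v (show i < 2 ^ k by omega),
        toArray_succ w (show i < 2 ^ k by omega)]
      rw [ih' (by omega), ih' (by omega), h _ (Nat.lt_succ_self k)]

/-- The ratio used to cut an interval belongs to generation `k`, while its length depends only on
earlier generations; hence the two are independent. -/
lemma lintegral_length_mul_sq {k j : ℕ} (hj : j < 2 ^ k) {g : ℝ → ℝ} (hg : Measurable g) :
    ∫⁻ v, (ENNReal.ofReal (g (toArray v k (j + 1))) *
        ENNReal.ofReal (Y (toArray v) k (j + 1) - Y (toArray v) k j)) ^ 2 ∂splitLaw =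
      (∫⁻ x, ENNReal.ofReal (g x) ^ 2 ∂uniform) *
      ∫⁻ v, ENNReal.ofReal (Y (toArray v) k (j + 1) - Y (toArray v) k j) ^ 2 ∂splitLaw := by
  have hi : IndepFun (fun v => ENNReal.ofReal (g (toArray v k (j + 1))) ^ 2)
      (fun v => ENNReal.ofReal (Y (toArray v) k (j + 1) - Y (toArray v) k j) ^ 2) splitLaw := by
    refine indepFun_of_dependsOn (s := {q | q.1.1 = k}) (t := {q | q.1.1 < k}) ?_ (by fun_prop)
      (by fun_prop) ?_ ?_
    · exact Set.disjoint_left.2 fun q h1 h2 => (ne_of_lt h2) h1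
    · intro v w h
      simp only [toArray_succ _ hj]
      rw [h _ rfl]
    · intro v w h
      simp only
      have h1 := dependsOn_Y hj.le h
      have h2 := dependsOn_Y (Nat.succ_le_of_lt hj) h
      simp only at h1 h2
      rw [h1, h2]
  simp_rw [mul_pow]
  refine (lintegral_mul_eq_lintegral_mul_lintegral_of_indepFun (by fun_prop) (by fun_prop)
    hi).trans ?_
  congr 1
  set q : SplitIndex := ⟨(k, j + 1), by simp, by simp only; omega⟩
  have hq : splitLaw.map (fun v => v q) = uniform := Measure.infinitePi_map_eval _ q
  rw [← hq, lintegral_map (by fun_prop) (by fun_prop)]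
  exact lintegral_congr fun v => by rw [toArray_succ v hj]

lemma lintegral_length_sq {k j : ℕ} (hj : j < 2 ^ k) :
    ∫⁻ v, ENNReal.ofReal (Y (toArray v) k (j + 1) - Y (toArray v) k j) ^ 2 ∂splitLaw
      = 3⁻¹ ^ k := by
  induction k generalizing j with
  | zero =>
    obtain rfl : j = 0 := by simpa using hj
    simp [Y]
  | succ k ih =>
    rw [pow_succ'] at hj
    obtain ⟨i, rfl | rfl⟩ := Nat.even_or_odd' j
    · have hi : i < 2 ^ k := by omega
      rw [pow_succ', ← ih hi, ← lintegral_uniform_sq,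
        ← lintegral_length_mul_sq hi (g := fun x => x) measurable_id]
      refine lintegral_congr_ae (ae_splitLaw_mem_Icc.mono fun v hv => ?_)
      simp only
      rw [← ENNReal.ofReal_mul ((unitRatios_toArray hv).mem hi).1, Y_succ_even, Y_succ_odd]
      ring_nf
    · have hi : i < 2 ^ k := by omega
      rw [pow_succ', ← ih hi, ← lintegral_uniform_one_sub_sq,
        ← lintegral_length_mul_sq hi (g := fun x => 1 - x) (by fun_prop)]
      refine lintegral_congr_ae (ae_splitLaw_mem_Icc.mono fun v hv => ?_)
      simp only
      rw [← ENNReal.ofReal_mul (sub_nonneg.2 ((unitRatios_toArray hv).mem hi).2),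
        show 2 * i + 1 + 1 = 2 * (i + 1) by ring, Y_succ_even, Y_succ_odd]
      ring_nf

lemma measurable_lintegral_cutGap (k : ℕ) :
    Measurable fun v => ∫⁻ x, cutGap (toArray v) k x ∂uniform :=
  (measurable_cutGap_toArray k).lintegral_prod_right'

lemma lintegral_lintegral_cutGap_le (k : ℕ) :
    ∫⁻ v, ∫⁻ x, cutGap (toArray v) k x ∂uniform ∂splitLaw ≤ ENNReal.ofReal ((2 / 3) ^ k) := by
  calc ∫⁻ v, ∫⁻ x, cutGap (toArray v) k x ∂uniform ∂splitLaw
      ≤ ∫⁻ v, ∑ j ∈ Finset.range (2 ^ k),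
          ENNReal.ofReal (Y (toArray v) k (j + 1) - Y (toArray v) k j) ^ 2 ∂splitLaw :=
        lintegral_mono_ae (ae_splitLaw_mem_Icc.mono fun v hv =>
          lintegral_cutGap_le (unitRatios_toArray hv) k)
    _ = ∑ j ∈ Finset.range (2 ^ k), 3⁻¹ ^ k := by
        rw [lintegral_finsetSum _ fun j _ => by fun_prop]
        exact Finset.sum_congr rfl fun j hj => lintegral_length_sq (Finset.mem_range.1 hj)
    _ = ENNReal.ofReal ((2 / 3) ^ k) := by
        have h3 : (3⁻¹ : ℝ≥0∞) = ENNReal.ofReal 3⁻¹ := by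
          rw [ENNReal.ofReal_inv_of_pos (by norm_num)]; simp
        rw [Finset.sum_const, Finset.card_range, nsmul_eq_mul, h3,
          ← ENNReal.ofReal_pow (by norm_num), ← ENNReal.ofReal_natCast,
          ← ENNReal.ofReal_mul (by positivity)]
        congr 1
        push_cast
        rw [div_eq_mul_inv, mul_pow]

/-- A series of `[0, 1]`-valued random variables with geometrically decaying means has finite
moments of all orders. -/
lemma lintegral_tsum_pow_ne_top {Ω : Type*} [MeasurableSpace Ω] {P : Measure Ω}
    [IsProbabilityMeasure P] {g : ℕ → Ω → ℝ≥0∞} {ρ : ℝ} (hρ0 : 0 ≤ ρ) (hρ : ρ < 1)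
    (hg : ∀ k, Measurable (g k)) (h1 : ∀ᵐ ω ∂P, ∀ k, g k ω ≤ 1)
    (hE : ∀ k, ∫⁻ ω, g k ω ∂P ≤ ENNReal.ofReal (ρ ^ k)) (n : ℕ) :
    ∫⁻ ω, (∑' k, g k ω) ^ n ∂P ≠ ∞ := by
  rcases Nat.eq_zero_or_pos n with rfl | hn
  · simp
  -- With `s = ∑ (k+1)^(2n) g k`, the bounds `g k ^ n ≤ g k` and `(k+1)^(2n) g k ≤ s` give `g k ≤
  -- (k+1)^(-2) s^(1/n)`. Summing over `k` yields `(∑ g k)^n ≤ C^n s`, and the mean of `s` is at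
  -- most `∑ (k+1)^(2n) ρ^k`.
  set C : ℝ≥0∞ := ∑' k : ℕ, ENNReal.ofReal (1 / ((k : ℝ) + 1) ^ 2) with hC
  have hCtop : C ≠ ∞ := by
    have hs : Summable fun k : ℕ => 1 / ((k : ℝ) + 1) ^ 2 := by
      have := (summable_nat_add_iff 1).2 (Real.summable_one_div_nat_pow.2 one_lt_two)
      simpa using this
    exact hs.tsum_ofReal_ne_top
  have hpt : ∀ ω, (∀ k, g k ω ≤ 1) → (∑' k, g k ω) ^ n ≤
      C ^ n * ∑' k : ℕ, ENNReal.ofReal (((k : ℝ) + 1) ^ (2 * n)) * g k ω := by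
    intro ω hω
    set s : ℝ≥0∞ := ∑' k : ℕ, ENNReal.ofReal (((k : ℝ) + 1) ^ (2 * n)) * g k ω with hs
    have hk : ∀ k, g k ω ≤ ENNReal.ofReal (1 / ((k : ℝ) + 1) ^ 2) * s ^ ((n : ℝ)⁻¹) := by
      intro k
      have h2 : ENNReal.ofReal (((k : ℝ) + 1) ^ 2) * g k ω ≤ s ^ ((n : ℝ)⁻¹) := by
        rw [ENNReal.le_rpow_inv_iff (by exact_mod_cast hn), ENNReal.rpow_natCast, mul_pow,
          ← ENNReal.ofReal_pow (by positivity), ← pow_mul]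
        refine le_trans ?_ (ENNReal.le_tsum k)
        gcongr
        exact pow_le_of_le_one zero_le (hω k) hn.ne'
      calc g k ω = ENNReal.ofReal (1 / ((k : ℝ) + 1) ^ 2) *
            (ENNReal.ofReal (((k : ℝ) + 1) ^ 2) * g k ω) := by
            rw [← mul_assoc, ← ENNReal.ofReal_mul (by positivity),
              one_div_mul_cancel (by positivity), ENNReal.ofReal_one, one_mul]
        _ ≤ _ := by gcongr
    calc (∑' k, g k ω) ^ n
        ≤ (∑' k : ℕ, ENNReal.ofReal (1 / ((k : ℝ) + 1) ^ 2) * s ^ ((n : ℝ)⁻¹)) ^ n := by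
          gcongr with k
          exact hk k
      _ = C ^ n * s := by
          rw [ENNReal.tsum_mul_right, mul_pow, ← ENNReal.rpow_natCast (s ^ ((n : ℝ)⁻¹)),
            ENNReal.rpow_inv_rpow (by exact_mod_cast hn.ne')]
  refine ne_top_of_le_ne_top ?_ (lintegral_mono_ae (h1.mono fun ω hω => hpt ω hω))
  rw [lintegral_const_mul _ (Measurable.tsum fun k => (hg k).const_mul _)]
  refine ENNReal.mul_ne_top (ENNReal.pow_ne_top hCtop) ?_
  rw [lintegral_tsum fun k => ((hg k).const_mul _).aemeasurable]
  have hs : Summable fun k : ℕ => ((k : ℝ) + 1) ^ (2 * n) * ρ ^ k := by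
    simp_rw [add_pow, one_pow, mul_one, Finset.sum_mul]
    refine summable_sum fun i _ => ?_
    have := summable_pow_mul_geometric_of_norm_lt_one i
      (show ‖ρ‖ < 1 by rwa [Real.norm_of_nonneg hρ0])
    refine (this.mul_left ((2 * n).choose i : ℝ)).congr fun k => by ring
  refine ne_top_of_le_ne_top hs.tsum_ofReal_ne_top (ENNReal.tsum_le_tsum fun k => ?_)
  rw [lintegral_const_mul _ (hg k), ENNReal.ofReal_mul (by positivity)]
  gcongr
  exact hE k

lemma lintegral_cutCumulant_pow_ne_top (n : ℕ) :
    ∫⁻ v, cutCumulant v 0 ^ n ∂splitLaw ≠ ∞ := by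
  simp only [cutCumulant, zero_add, pow_one]
  exact lintegral_tsum_pow_ne_top (by norm_num) (by norm_num) measurable_lintegral_cutGap
    (ae_splitLaw_mem_Icc.mono fun v hv k => lintegral_cutGap_le_one (unitRatios_toArray hv) k)
    lintegral_lintegral_cutGap_le n

end Lengths

/-! ### The moment polynomial -/

section Coefficients

/-- The coefficients of the moment polynomials. -/
noncomputable def momentCoeff (n j : ℕ) : ℝ≥0∞ :=
  ∫⁻ v, (bell (cutCumulant v) n).coeff j ∂splitLaw

lemma momentCoeff_ne_top (n j : ℕ) : momentCoeff n j ≠ ∞ := by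
  obtain ⟨K, hK⟩ := exists_coeff_bell_le n
  -- Adding 1 to `cutCumulant v 0` meets the condition `1 ≤ s` of the Bell coefficient bound.
  have h : momentCoeff n j ≤ ∫⁻ v, K * (1 + cutCumulant v 0) ^ n ∂splitLaw :=
    lintegral_mono_ae (ae_splitLaw_mem_Icc.mono fun v hv => hK _ _ le_self_add
      (fun i => (cutCumulant_le hv i).trans le_add_self) j)
  refine ne_top_of_le_ne_top ?_ h
  have hm := measurable_cutCumulant 0
  rw [lintegral_const_mul _ (by fun_prop)]
  refine ENNReal.mul_ne_top (ENNReal.natCast_ne_top _) ?_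
  simp_rw [add_pow, one_pow, one_mul]
  rw [lintegral_finsetSum _ fun j _ => by fun_prop]
  refine ENNReal.sum_ne_top.2 fun i _ => ?_
  rw [lintegral_mul_const _ (by fun_prop)]
  exact ENNReal.mul_ne_top (lintegral_cutCumulant_pow_ne_top _) (ENNReal.natCast_ne_top _)

lemma momentCoeff_self_ne_zero (n : ℕ) : momentCoeff n n ≠ 0 := by
  simp only [momentCoeff, coeff_bell_self]
  rw [Ne, lintegral_eq_zero_iff ((measurable_cutCumulant 0).pow_const n)]
  intro h
  obtain ⟨v, hv, hv'⟩ := (h.and ae_splitLaw_mem_Icc).exists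
  exact pow_ne_zero n (cutCumulant_zero_ne_zero hv') hv

lemma momentCoeff_zero {n : ℕ} (hn : 1 ≤ n) : momentCoeff n 0 = 0 := by
  obtain ⟨n, rfl⟩ : ∃ m, n = m + 1 := ⟨n - 1, by omega⟩
  simp [momentCoeff, coeff_bell_succ_zero]

/-- The polynomial giving the moments of order `n`. -/
noncomputable def momentPolynomial (n : ℕ) : Polynomial ℝ :=
  ∑ j ∈ Finset.range (n + 1), Polynomial.C (momentCoeff n j).toReal * Polynomial.X ^ j

lemma coeff_momentPolynomial {n j : ℕ} (hj : j ≤ n) :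
    (momentPolynomial n).coeff j = (momentCoeff n j).toReal := by
  simp [momentPolynomial, Polynomial.finsetSum_coeff, Polynomial.coeff_C_mul,
    Polynomial.coeff_X_pow]
  omega

lemma natDegree_momentPolynomial (n : ℕ) : (momentPolynomial n).natDegree = n := by
  refine Polynomial.natDegree_eq_of_le_of_coeff_ne_zero ?_ ?_
  · refine Polynomial.natDegree_sum_le_of_forall_le _ _ fun j hj => ?_
    exact (Polynomial.natDegree_C_mul_X_pow_le _ _).trans
      (Nat.lt_succ_iff.1 (Finset.mem_range.1 hj))
  · rw [coeff_momentPolynomial le_rfl]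
    exact ENNReal.toReal_ne_zero.2 ⟨momentCoeff_self_ne_zero n, momentCoeff_ne_top n n⟩

lemma eval_zero_momentPolynomial {n : ℕ} (hn : 1 ≤ n) : (momentPolynomial n).eval 0 = 0 := by
  rw [← Polynomial.coeff_zero_eq_eval_zero, coeff_momentPolynomial (Nat.zero_le n),
    momentCoeff_zero hn, ENNReal.toReal_zero]

lemma lintegral_eval_bell (n : ℕ) (r : ℝ≥0) :
    ∫⁻ v, (bell (cutCumulant v) n).eval (r : ℝ≥0∞) ∂splitLaw =
      ENNReal.ofReal ((momentPolynomial n).eval (r : ℝ)) := by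
  simp_rw [eval_bell, momentPolynomial, Polynomial.eval_finsetSum]
  have hm := fun j => measurable_coeff_bell measurable_cutCumulant n j
  rw [lintegral_finsetSum _ fun j _ => (hm j).mul_const _,
    ENNReal.ofReal_sum_of_nonneg fun j _ => by simp; positivity]
  refine Finset.sum_congr rfl fun j _ => ?_
  rw [lintegral_mul_const _ (hm j)]
  simp only [Polynomial.eval_mul, Polynomial.eval_C, Polynomial.eval_pow, Polynomial.eval_X]
  rw [ENNReal.ofReal_mul ENNReal.toReal_nonneg, ENNReal.ofReal_toReal (momentCoeff_ne_top n j),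
    ENNReal.ofReal_pow r.coe_nonneg, ENNReal.ofReal_coe_nnreal, momentCoeff]

end Coefficients

/-! ### The canonical product space -/

section Model

/-- The index set of all the variables of the model. -/
abbrev ModelIndex : Type := ℕ+ ⊕ (ℕ+ × ℕ) ⊕ SplitIndex

/-- The laws of the variables of the model. -/
noncomputable def coordLaw (r : ℝ≥0) : ModelIndex → Measure ℝ
  | .inl _ => (poissonMeasure r).map (Nat.cast : ℕ → ℝ)
  | .inr _ => uniform

instance isProbabilityMeasure_coordLaw (r : ℝ≥0) (a : ModelIndex) :
    IsProbabilityMeasure (coordLaw r a) := by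
  rcases a with k | b
  · exact Measure.isProbabilityMeasure_map (measurable_of_countable _).aemeasurable
  · exact inferInstanceAs (IsProbabilityMeasure uniform)

/-- The joint law of the variables of the model. -/
noncomputable abbrev modelLaw (r : ℝ≥0) : Measure (ModelIndex → ℝ) :=
  Measure.infinitePi (coordLaw r)

/-- The number of points in a layer. -/
noncomputable def count (k : ℕ) (w : ModelIndex → ℝ) : ℕ := ⌊w (.inl k.succPNat)⌋₊

/-- The points of a layer. -/
def point (k i : ℕ) (w : ModelIndex → ℝ) : ℝ := w (.inr (.inl (k.succPNat, i)))

/-- The split ratios. -/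
def ratios (w : ModelIndex → ℝ) : SplitIndex → ℝ := fun q => w (.inr (.inr q))

/-- The sum of `f k` over the points of layer `k`. -/
noncomputable def layerSum (f : ℕ → ℝ → ℝ≥0∞) (k : ℕ) (w : ModelIndex → ℝ) : ℝ≥0∞ :=
  ∑ i ∈ Finset.range (count k w), f k (point k i w)

@[fun_prop]
lemma measurable_count (k : ℕ) : Measurable (count k) :=
  Nat.measurable_floor.comp (measurable_pi_apply _)

@[fun_prop]
lemma measurable_point (k i : ℕ) : Measurable (point k i) := measurable_pi_apply _

@[fun_prop]
lemma measurable_ratios : Measurable ratios := by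
  unfold ratios
  fun_prop

lemma measurable_layerSum {f : ℕ → ℝ → ℝ≥0∞} (hf : ∀ k, Measurable (f k)) (k : ℕ) :
    Measurable (layerSum f k) :=
  measurable_sum_range_of_measurable (measurable_count k) fun i =>
    (hf k).comp (measurable_point k i)

/-- The indices of the variables that determine layer `k`. -/
def layerIndex (k : ℕ) : Set ModelIndex :=
  {a | a = .inl k.succPNat ∨ ∃ i, a = .inr (.inl (k.succPNat, i))}

lemma dependsOn_layerSum (f : ℕ → ℝ → ℝ≥0∞) (k : ℕ) :
    DependsOn (layerSum f k) (layerIndex k) := by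
  intro v w h
  simp only [layerSum, count, point]
  rw [h _ (Or.inl rfl)]
  exact Finset.sum_congr rfl fun i _ => by rw [h _ (Or.inr ⟨i, rfl⟩)]

lemma map_count (r : ℝ≥0) (k : ℕ) : (modelLaw r).map (count k) = poissonMeasure r := by
  have h : (modelLaw r).map (fun w => w (.inl k.succPNat)) =
      (poissonMeasure r).map (Nat.cast : ℕ → ℝ) := Measure.infinitePi_map_eval _ _
  have hc : (modelLaw r).map (count k) =
      ((modelLaw r).map fun w => w (.inl k.succPNat)).map Nat.floor :=
    (Measure.map_map (f := fun w : ModelIndex → ℝ => w (.inl k.succPNat)) Nat.measurable_floor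
      (measurable_pi_apply _)).symm
  rw [hc, h, Measure.map_map Nat.measurable_floor (measurable_of_countable _)]
  have : (Nat.floor ∘ (Nat.cast : ℕ → ℝ)) = id := by
    ext n
    simp
  rw [this, Measure.map_id]

lemma map_point (r : ℝ≥0) (k i : ℕ) : (modelLaw r).map (point k i) = uniform :=
  Measure.infinitePi_map_eval _ _

lemma map_ratios (r : ℝ≥0) : (modelLaw r).map ratios = splitLaw :=
  Measure.map_infinitePi_infinitePi_of_inj (P := coordLaw r)
    (f := fun q : SplitIndex => (.inr (.inr q) : ModelIndex))
    (Sum.inr_injective.comp Sum.inr_injective)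

/-- For deterministic `f`, each layer is compound Poisson with jumps `f k` of a uniform point. All
the independence needed is read off from disjoint sets of coordinates. -/
lemma lintegral_layerSums_pow (r : ℝ≥0) {f : ℕ → ℝ → ℝ≥0∞} (hf : ∀ k, Measurable (f k))
    (hfin : ∀ n, ∑' k, ∫⁻ x, f k x ^ (n + 1) ∂uniform ≠ ∞) (n : ℕ) :
    ∫⁻ w, (∑' k, layerSum f k w) ^ n ∂modelLaw r =
      (bell (fun n => ∑' k, ∫⁻ x, f k x ^ (n + 1) ∂uniform) n).eval (r : ℝ≥0∞) := by
  refine lintegral_tsum_pow_eq_eval_bell (measurable_layerSum hf) (fun k => ?_) (fun m => ?_)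
    hfin n
  · have hφ : ∀ i, momentSeries (modelLaw r) (fun w => f k (point k i w)) =
        momentSeries uniform (f k) := fun i => by
      ext n
      rw [coeff_momentSeries, coeff_momentSeries, ← map_point r k i,
        lintegral_map ((hf k).pow_const n) (measurable_point k i)]
    rw [← derivative_momentSeries]
    have hfk := hf k
    refine derivative_momentSeries_poissonSum (measurable_count k)
      (Z := fun i w => f k (point k i w))
      (fun i => (hf k).comp (measurable_point k i)) (map_count r k) (fun m => ?_) hφ
      (fun m => ?_)
    · refine indepFun_of_dependsOn (s := {a | a = .inl k.succPNat})
        (t := {a | ∃ i, a = .inr (.inl (k.succPNat, i))}) ?_ (measurable_count k)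
        (by fun_prop) ?_ ?_
      · refine Set.disjoint_left.2 ?_
        rintro _ rfl ⟨i, hi⟩
        simp at hi
      · intro v w h
        simp only [count]
        rw [h _ rfl]
      · intro v w h
        simp only [point]
        exact Finset.sum_congr rfl fun i _ => by rw [h _ ⟨i, rfl⟩]
    · refine indepFun_of_dependsOn (s := {a | ∃ i < m, a = .inr (.inl (k.succPNat, i))})
        (t := {a | a = .inr (.inl (k.succPNat, m))}) ?_ (by fun_prop) (by fun_prop) ?_ ?_
      · refine Set.disjoint_left.2 ?_
        rintro _ ⟨i, hi, rfl⟩ h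
        simp only [Set.mem_ofPred_eq, Sum.inr.injEq, Sum.inl.injEq, Prod.mk.injEq] at h
        omega
      · intro v w h
        simp only [point]
        exact Finset.sum_congr rfl fun i hi => by rw [h _ ⟨i, Finset.mem_range.1 hi, rfl⟩]
      · intro v w h
        simp only [point]
        rw [h _ rfl]
  · refine indepFun_of_dependsOn (s := {a | ∃ k < m, a ∈ layerIndex k}) (t := layerIndex m) ?_
      (Finset.measurable_fun_sum _ fun k _ => measurable_layerSum hf k) (measurable_layerSum hf m)
      ?_ (dependsOn_layerSum f m)
    · refine Set.disjoint_left.2 ?_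
      rintro a ⟨k, hk, h1⟩ h2
      have : k.succPNat = m.succPNat := by
        rcases h1 with rfl | ⟨i, rfl⟩ <;> rcases h2 with h | ⟨j, h⟩
        · simpa using h
        · simp at h
        · simp at h
        · simp only [Sum.inr.injEq, Sum.inl.injEq, Prod.mk.injEq] at h
          exact h.1
      exact hk.ne (Nat.succPNat_injective this)
    · intro v w h
      exact Finset.sum_congr rfl fun k hk => dependsOn_layerSum f k fun a ha =>
        h a ⟨k, Finset.mem_range.1 hk, ha⟩

/-- The total cut distance `∑_{(k, x) ∈ S} |x - Y_{k, J_k(x)}|`. -/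
noncomputable def totalGap (w : ModelIndex → ℝ) : ℝ≥0∞ :=
  ∑' k, layerSum (cutGap (toArray (ratios w))) k w

/-- The variables of the model with the split ratios erased. -/
def eraseRatios (w : ModelIndex → ℝ) : ModelIndex → ℝ
  | .inr (.inr _) => 0
  | a => w a

lemma measurable_eraseRatios : Measurable eraseRatios := by
  refine measurable_pi_lambda _ fun a => ?_
  rcases a with k | p | q
  · exact measurable_pi_apply _
  · exact measurable_pi_apply _
  · exact measurable_const

lemma measurable_layerSums_prod :
    Measurable fun p : (SplitIndex → ℝ) × (ModelIndex → ℝ) =>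
      ∑' k, layerSum (cutGap (toArray p.1)) k p.2 := by
  refine Measurable.tsum fun k => ?_
  have hN : Measurable fun p : (SplitIndex → ℝ) × (ModelIndex → ℝ) => count k p.2 :=
    (measurable_count k).comp measurable_snd
  have hp : ∀ i, Measurable fun p : (SplitIndex → ℝ) × (ModelIndex → ℝ) =>
      (p.1, point k i p.2) := fun i =>
    measurable_fst.prodMk ((measurable_point k i).comp measurable_snd)
  have hZ : ∀ i, Measurable fun p : (SplitIndex → ℝ) × (ModelIndex → ℝ) =>
      cutGap (toArray p.1) k (point k i p.2) := fun i => by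
    have h := Measurable.comp (g := fun q : (SplitIndex → ℝ) × ℝ => cutGap (toArray q.1) k q.2)
      (measurable_cutGap_toArray k) (hp i)
    simp only [Function.comp_def] at h
    exact h
  exact measurable_sum_range_of_measurable hN hZ

lemma measurable_totalGap : Measurable totalGap := by
  have h : Measurable fun w : ModelIndex → ℝ => (ratios w, w) :=
    measurable_ratios.prodMk measurable_id
  have h' := measurable_layerSums_prod.comp h
  simp only [Function.comp_def] at h'
  exact h'

lemma layerSum_eraseRatios (f : ℕ → ℝ → ℝ≥0∞) (k : ℕ) (w : ModelIndex → ℝ) :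
    layerSum f k (eraseRatios w) = layerSum f k w := rfl

lemma indepFun_ratios_eraseRatios (r : ℝ≥0) : IndepFun ratios eraseRatios (modelLaw r) := by
  refine indepFun_of_dependsOn (s := {a | ∃ q, a = .inr (.inr q)})
    (t := {a | ∃ q, a = .inr (.inr q)}ᶜ) disjoint_compl_right measurable_ratios
    measurable_eraseRatios ?_ ?_
  · intro v w h
    ext q
    exact h _ ⟨q, rfl⟩
  · intro v w h
    ext a
    rcases a with k | p | q
    · exact h _ (by simp)
    · exact h _ (by simp)
    · rfl

lemma cutCumulant_ne_top : ∀ᵐ v ∂splitLaw, ∀ n, cutCumulant v n ≠ ∞ := by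
  have h : ∫⁻ v, cutCumulant v 0 ∂splitLaw ≠ ∞ := by
    simpa using lintegral_cutCumulant_pow_ne_top 1
  filter_upwards [ae_lt_top (measurable_cutCumulant 0) h, ae_splitLaw_mem_Icc] with v h1 h2 n
  exact ne_top_of_le_ne_top h1.ne (cutCumulant_le h2 n)

/-- The moments of the total cut distance are polynomials in the intensity. -/
lemma lintegral_totalGap_pow (r : ℝ≥0) (n : ℕ) :
    ∫⁻ w, totalGap w ^ n ∂modelLaw r = ENNReal.ofReal ((momentPolynomial n).eval (r : ℝ)) := by
  have hm := measurable_layerSums_prod.pow_const n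
  have h1 : ∫⁻ w, totalGap w ^ n ∂modelLaw r =
      ∫⁻ v, ∫⁻ w, (∑' k, layerSum (cutGap (toArray v)) k w) ^ n
        ∂((modelLaw r).map eraseRatios) ∂splitLaw := by
    -- Conditioning on the ratios: they are independent of the remaining variables, so the joint law
    -- is a product and Tonelli applies.
    rw [← map_ratios r, ← lintegral_prod _ hm.aemeasurable,
      ← (indepFun_iff_map_prod_eq_prod_map_map measurable_ratios.aemeasurable
        measurable_eraseRatios.aemeasurable).1 (indepFun_ratios_eraseRatios r),
      lintegral_map hm (measurable_ratios.prodMk measurable_eraseRatios)]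
    simp only [layerSum_eraseRatios, totalGap]
  rw [h1, ← lintegral_eval_bell]
  refine lintegral_congr_ae (cutCumulant_ne_top.mono fun v hv => ?_)
  have hf : ∀ k, Measurable (cutGap (toArray v) k) := fun k => by
    have h := (measurable_cutGap_toArray k).comp
      (measurable_prodMk_left (x := v) (β := ℝ))
    simp only [Function.comp_def] at h
    exact h
  have hL := measurable_layerSum hf
  simp only
  rw [lintegral_map (Measurable.pow_const (Measurable.tsum hL) n) measurable_eraseRatios]
  simp only [layerSum_eraseRatios]
  exact lintegral_layerSums_pow r hf hv n

lemma eval_momentPolynomial_nonneg (n : ℕ) (r : ℝ≥0) :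
    0 ≤ (momentPolynomial n).eval (r : ℝ) := by
  rw [momentPolynomial, Polynomial.eval_finsetSum]
  exact Finset.sum_nonneg fun j _ => by simp; positivity

end Model

/-! ### Transfer to an arbitrary model -/

section Points

variable {Ω : Type*} [MeasurableSpace Ω] {P : Measure Ω}

lemma ae_ne_of_indepFun_uniform {X Y : Ω → ℝ} (hX : HasLaw X uniform P)
    (hY : HasLaw Y uniform P) (h : IndepFun X Y P) : ∀ᵐ ω ∂P, X ω ≠ Y ω := by
  -- Finiteness of `P` is recovered from the finite law of `X`.
  have hP : IsFiniteMeasure P := by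
    refine ⟨?_⟩
    rw [← Set.preimage_univ (f := X), ← Measure.map_apply_of_aemeasurable hX.aemeasurable .univ,
      hX.map_eq]
    exact measure_lt_top _ _
  have hmap := (indepFun_iff_map_prod_eq_prod_map_map hX.aemeasurable hY.aemeasurable).1 h
  rw [hX.map_eq, hY.map_eq] at hmap
  refine ae_of_ae_map (f := fun ω => (X ω, Y ω)) (p := fun p => p.1 ≠ p.2)
    (hX.aemeasurable.prodMk hY.aemeasurable) ?_
  rw [hmap]
  refine (Measure.ae_prod_iff_ae_ae ?_).2 (Filter.Eventually.of_forall fun x => ?_)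
  · exact (measurableSet_eq_fun measurable_fst measurable_snd).compl
  · exact (ae_restrict_of_ae (Measure.ae_ne volume x)).mono fun y hy => hy.symm

/-- A set counts coinciding points once, while the indexed sum counts them with multiplicity;
distinctness within each layer reconciles the two. -/
lemma tsum_points {M : ℕ+ → ℕ} {x : ℕ+ → ℕ → ℝ}
    (hx : ∀ k i j, i ≠ j → x k i ≠ x k j) (f : ℕ+ × ℝ → ℝ≥0∞) :
    ∑' p : {p : ℕ+ × ℝ | ∃ i < M p.1, p.2 = x p.1 i}, f p =
      ∑' k : ℕ, ∑ i ∈ Finset.range (M k.succPNat), f (k.succPNat, x k.succPNat i) := by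
  set S : Set (ℕ+ × ℝ) := {p | ∃ i < M p.1, p.2 = x p.1 i}
  let e : (Σ k : ℕ, Fin (M k.succPNat)) → S := fun a =>
    ⟨(a.1.succPNat, x a.1.succPNat a.2), a.2, a.2.2, rfl⟩
  have he : Function.Bijective e := by
    constructor
    · rintro ⟨k, i⟩ ⟨l, j⟩ h
      have h' := congrArg Subtype.val h
      simp only [e, Prod.mk.injEq] at h'
      obtain rfl : k = l := Nat.succPNat_injective h'.1
      by_contra hne
      refine hx k.succPNat i j (fun hij => hne ?_) h'.2
      rw [Fin.ext hij]
    · rintro ⟨⟨k, y⟩, i, hi, hy⟩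
      obtain ⟨l, rfl⟩ : ∃ l : ℕ, k = l.succPNat := ⟨k.natPred, (PNat.succPNat_natPred k).symm⟩
      exact ⟨⟨l, i, hi⟩, Subtype.ext (Prod.ext rfl hy.symm)⟩
  rw [← (Equiv.ofBijective e he).tsum_eq, ENNReal.tsum_sigma']
  refine tsum_congr fun k => ?_
  rw [tsum_fintype, ← Fin.sum_univ_eq_sum_range (fun i => f (k.succPNat, x k.succPNat i))]
  rfl

variable {lam : ℝ} {N : ℕ+ → Ω → ℕ} {V : ℕ+ → ℕ → Ω → ℝ} {S : Ω → Set (ℕ+ × ℝ)}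
  {U : ℕ → ℕ → Ω → ℝ}

/-- All the variables of the model, as one vector. -/
def modelVector (N : ℕ+ → Ω → ℕ) (V : ℕ+ → ℕ → Ω → ℝ) (U : ℕ → ℕ → Ω → ℝ) (ω : Ω) :
    ModelIndex → ℝ
  | .inl k => (N k ω : ℝ)
  | .inr (.inl (k, i)) => V k i ω
  | .inr (.inr q) => U q.1.1 q.1.2 ω

lemma IsModel.hasLaw_modelVector (h : IsModel P lam N V S U) :
    HasLaw (modelVector N V U) (modelLaw lam.toNNReal) P := by
  have hl : ∀ a : ModelIndex, HasLaw (fun ω => modelVector N V U ω a)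
      (coordLaw lam.toNNReal a) P := by
    rintro (k | ⟨k, i⟩ | q)
    · have hc : Measurable (Nat.cast : ℕ → ℝ) := measurable_of_countable _
      refine ⟨hc.comp_aemeasurable (h.law_N k).aemeasurable, ?_⟩
      simp only [coordLaw]
      rw [← (h.law_N k).map_eq,
        AEMeasurable.map_map_of_aemeasurable hc.aemeasurable (h.law_N k).aemeasurable]
      rfl
    · exact h.law_V k i
    · exact h.law_U q
  refine iIndepFun.hasLaw_infinitePi hl ?_ (aemeasurable_pi_iff.2 fun a => (hl a).aemeasurable)
  convert h.indep using 3 with a ω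
  rcases a with k | ⟨k, i⟩ | q <;> rfl

lemma IsModel.ae_unitRatios (h : IsModel P lam N V S U) :
    ∀ᵐ ω ∂P, UnitRatios fun k j => U k j ω := by
  refine ae_all_iff.2 fun q => ?_
  refine ae_of_ae_map (p := fun x => x ∈ Set.Icc (0 : ℝ) 1) (h.law_U q).aemeasurable ?_
  rw [(h.law_U q).map_eq]
  exact ae_restrict_mem measurableSet_Icc

/-- The endpoint 1 lies in no interval `[Y k j, Y k (j+1))`, where `J` is not meaningful; it is
discarded as a null set. -/
lemma IsModel.ae_mem_Ico (h : IsModel P lam N V S U) :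
    ∀ᵐ ω ∂P, ∀ k i, V k i ω ∈ Set.Ico (0 : ℝ) 1 := by
  refine ae_all_iff.2 fun k => ae_all_iff.2 fun i => ?_
  refine ae_of_ae_map (p := fun x => x ∈ Set.Ico (0 : ℝ) 1) (h.law_V k i).aemeasurable ?_
  rw [(h.law_V k i).map_eq]
  exact ae_restrict_Icc_mem_Ico

lemma IsModel.ae_injective (h : IsModel P lam N V S U) :
    ∀ᵐ ω ∂P, ∀ k i j, i ≠ j → V k i ω ≠ V k j ω := by
  refine ae_all_iff.2 fun k => ae_all_iff.2 fun i => ae_all_iff.2 fun j => ?_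
  by_cases hij : i = j
  · exact Filter.Eventually.of_forall fun ω h => absurd hij h
  · refine (ae_ne_of_indepFun_uniform (h.law_V k i) (h.law_V k j) ?_).mono fun ω hω _ => hω
    exact h.indep.indepFun (i := .inr (.inl (k, i))) (j := .inr (.inl (k, j))) (by simpa using hij)

lemma IsModel.ae_tsum_eq (h : IsModel P lam N V S U) :
    ∀ᵐ ω ∂P, ∑' p : S ω, ENNReal.ofReal (cutDist (fun k j => U k j ω) p) =
      totalGap (modelVector N V U ω) := by
  filter_upwards [h.points, h.ae_unitRatios, h.ae_mem_Ico, h.ae_injective] with ω hS hU hV hinj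
  rw [hS, tsum_points (M := fun k => N k ω) (x := fun k i => V k i ω) hinj fun p => ENNReal.ofReal (cutDist (fun k j => U k j ω) p)]
  refine tsum_congr fun k => ?_
  have hc : count k (modelVector N V U ω) = N k.succPNat ω := Nat.floor_natCast _
  rw [layerSum, hc]
  refine Finset.sum_congr rfl fun i _ => ?_
  rw [ofReal_cutDist hU k (hV _ _)]
  exact cutGap_congr (fun q => (toArray_apply (ratios (modelVector N V U ω)) q).symm) k _

lemma IsModel.lintegral_totalGap_pow (h : IsModel P lam N V S U) (n : ℕ) :
    ∫⁻ ω, totalGap (modelVector N V U ω) ^ n ∂P =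
      ENNReal.ofReal ((momentPolynomial n).eval (lam.toNNReal : ℝ)) := by
  rw [← RandomSplit.lintegral_totalGap_pow, ← h.hasLaw_modelVector.map_eq,
    lintegral_map' (measurable_totalGap.pow_const n).aemeasurable h.hasLaw_modelVector.aemeasurable]

lemma cutDist_nonneg (u : ℕ → ℕ → ℝ) (p : ℕ+ × ℝ) : 0 ≤ cutDist u p := abs_nonneg _

lemma IsModel.ae_totalGap_ne_top (h : IsModel P lam N V S U) :
    ∀ᵐ ω ∂P, totalGap (modelVector N V U ω) ≠ ∞ := by
  have h1 := h.lintegral_totalGap_pow 1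
  simp only [pow_one] at h1
  exact (ae_lt_top' (measurable_totalGap.comp_aemeasurable h.hasLaw_modelVector.aemeasurable)
    (h1 ▸ ENNReal.ofReal_ne_top)).mono fun ω hω => hω.ne

lemma IsModel.ae_summable (h : IsModel P lam N V S U) :
    ∀ᵐ ω ∂P, Summable fun p : S ω => cutDist (fun k j => U k j ω) p := by
  filter_upwards [h.ae_tsum_eq, h.ae_totalGap_ne_top] with ω h1 h2
  refine (ENNReal.summable_toReal (h1 ▸ h2)).congr fun p => ?_
  exact ENNReal.toReal_ofReal (cutDist_nonneg _ _)

lemma IsModel.ae_X_pow_eq (h : IsModel P lam N V S U) (n : ℕ) :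
    (fun ω => X lam (S ω) (fun k j => U k j ω) ^ n) =ᵐ[P]
      fun ω => (1 / lam) ^ n * (totalGap (modelVector N V U ω) ^ n).toReal := by
  filter_upwards [h.ae_tsum_eq] with ω h1
  rw [X, mul_pow, ← h1, ENNReal.toReal_pow, ENNReal.tsum_toReal_eq fun _ => ENNReal.ofReal_ne_top]
  simp only [ENNReal.toReal_ofReal (cutDist_nonneg _ _)]

end Points

end RandomSplit

open MeasureTheory in
theorem proposition12 (n : ℕ) (hn : 1 ≤ n) :
    ∃ Q : Polynomial ℝ, Q.natDegree = n ∧ Q.eval 0 = 0 ∧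
      ∀ (lam : ℝ), 0 < lam →
      ∀ {Ω : Type*} [MeasurableSpace Ω] (P : Measure Ω) [IsProbabilityMeasure P]
        (N : ℕ+ → Ω → ℕ) (V : ℕ+ → ℕ → Ω → ℝ) (S : Ω → Set (ℕ+ × ℝ)) (U : ℕ → ℕ → Ω → ℝ),
        RandomSplit.IsModel P lam N V S U →
          (∀ᵐ ω ∂P, Summable fun p : S ω => RandomSplit.cutDist (fun k j => U k j ω) p) ∧
          Integrable (fun ω => RandomSplit.X lam (S ω) (fun k j => U k j ω) ^ n) P ∧
          lam ^ n * ∫ ω, RandomSplit.X lam (S ω) (fun k j => U k j ω) ^ n ∂P = Q.eval lam := by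
  refine ⟨RandomSplit.momentPolynomial n, RandomSplit.natDegree_momentPolynomial n,
    RandomSplit.eval_zero_momentPolynomial hn, fun lam hlam Ω _ P _ N V S U h => ?_⟩
  have hX := h.ae_X_pow_eq n
  have hI := h.lintegral_totalGap_pow n
  have hm : AEMeasurable
      (fun ω => RandomSplit.totalGap (RandomSplit.modelVector N V U ω) ^ n) P :=
    (RandomSplit.measurable_totalGap.comp_aemeasurable
      h.hasLaw_modelVector.aemeasurable).pow_const n
  refine ⟨h.ae_summable, ?_, ?_⟩
  · rw [integrable_congr hX]
    exact (integrable_toReal_of_lintegral_ne_top hm (hI ▸ ENNReal.ofReal_ne_top)).const_mul _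
  · rw [integral_congr_ae hX, integral_const_mul, integral_toReal hm
      (h.ae_totalGap_ne_top.mono fun ω hω => (ENNReal.pow_ne_top hω).lt_top), hI,
      ENNReal.toReal_ofReal (RandomSplit.eval_momentPolynomial_nonneg n _),
      -- The prefactor `lam ^ n` cancels the normalisation `(1 / lam) ^ n` contained in `X`.
      Real.coe_toNNReal lam hlam.le, ← mul_assoc, ← mul_pow, mul_one_div_cancel hlam.ne', one_pow,
      one_mul]
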